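/- Let $X_n$ be a finite-dimensional complex simple Lie algebra; only its root system is used, that is, an irreducible reduced crystallographic root system $\Delta$ with simple roots $\alpha_a$, fundamental weights $\Lambda_a$ ($1\le a\le n$), positive roots $\Delta_+$, weight lattice $P$ and Weyl group $\mathcal W$. Let $(\cdot|\cdot)$ be the invariant form with $(\alpha|\alpha)=2$ for long roots $\alpha$, and let $t_a=2/(\alpha_a|\alpha_a)\in\{1,2,3\}$. Let $H=\{1,\dots,n\}\times\{1,2,\dots\}$, let $\mathcal N$ be the set of finitely supported families $N=(N_m^{(a)})_{(a,m)\in H}$ of non-negative integers, and for $(a,m),(b,k)\in H$ let $$B_{am,bk}=2\min(t_bm,t_ak)-\min(t_bm,t_a(k+1))-\min(t_bm,t_a(k-1)).$$ Let $(\tilde Q_m^{(a)}(y))_{(a,m)\in H}$ be a family of invertible power series in $\mathbb C[[y_1,\dots,y_n]]$ such that, with $\tilde Q_0^{(a)}=1$, for all $(a,m)\in H$ $$(\tilde Q_m^{(a)})^2=\tilde Q_{m+1}^{(a)}\tilde Q_{m-1}^{(a)}+y_a^m(\tilde Q_m^{(a)})^2\prod_{(b,k)\in H}(\tilde Q_k^{(b)})^{-(\alpha_a|\alpha_b)B_{am,bk}}$$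 (the exponents are integers, and all but finitely many are zero), and such that for each $a$ the limit $\lim_{m\to\infty}\tilde Q_m^{(a)}$ exists in $\mathbb C[[y]]$, in the sense that each coefficient is eventually constant. Put $x_a=e^{\Lambda_a}$, $y_a=e^{-\alpha_a}$, and, as formal sums of exponentials $e^\lambda$ ($\lambda\in P$), let $$Q_m^{(a)}(x)=x_a^m\,\tilde Q_m^{(a)}(y(x)),\qquad Q^\nu(x)=\prod_{(a,m)\in H}(Q_m^{(a)}(x))^{\nu_m^{(a)}}\quad(\nu\in\mathcal N).$$ For $\nu,N\in\mathcal N$ let $$P_m^{(a)}=\sum_{k\ge1}\min(m,k)\nu_k^{(a)}-\sum_{(b,k)\in H}(\alpha_a|\alpha_b)\min(t_bm,t_ak)N_k^{(b)},\qquad K(\nu,N)=\prod_{(a,m)\in H}\binom{P_m^{(a)}+N_m^{(a)}}{N_m^{(a)}},$$ where $\binom{z}{j}=z(z-1)\cdots(z-j+1)/j!$, and let $$K^0(x)=\sum_{N\in\mathcal N}K(0,N)\prod_{a=1}^n y_a^{\sum_{m}mN_m^{(a)}}\Big|_{y_a=e^{-\alpha_a}}.$$ For $\nu\in\mathcal N$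 and $\lambda\in P$ define $k^\nu_\lambda$ and $\mathcal N^\nu_\lambda$ by $$Q^\nu(x)\prod_{\alpha\in\Delta_+}(1-e^{-\alpha})=\sum_{\lambda\in P}k^\nu_\lambda e^\lambda,\qquad \mathcal N^\nu_\lambda=\Big\{N\in\mathcal N\ \Big|\ \sum_{(a,m)\in H}m\nu_m^{(a)}\Lambda_a-\sum_{(a,m)\in H}mN_m^{(a)}\alpha_a=\lambda\Big\}.$$ If $Q_1^{(1)}(x),\dots,Q_1^{(n)}(x)$ are $\mathcal W$-invariant (under $w(e^\lambda)=e^{w\lambda}$), then $$K^0(x)=\prod_{\alpha\in\Delta_+}(1-e^{-\alpha}).$$ Consequently, for all $\nu\in\mathcal N$ and $\lambda\in P$, the set $\mathcal N^\nu_\lambda$ is finite and $$k^\nu_\lambda=\sum_{N\in\mathcal N^\nu_\lambda}K(\nu,N).$$ -/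

import Mathlib

open scoped Nat

set_option linter.unusedSectionVars false

noncomputable section

namespace QSystem

section Form

variable {ι K V W : Type*} [Fintype ι] [Field K] [CharZero K] [AddCommGroup V] [Module K V]
  [AddCommGroup W] [Module K W] (P : RootPairing ι K V W) [P.IsCrystallographic]

/-- The largest squared length of a root with respect to the (integer valued) canonical invariant
form of the root system. -/
def maxLength : ℤ := ⨆ k, (P.posRootForm ℤ).rootLength k

/-- The number `(α_i | α_j)`, where `( | )` is the invariant form normalized by `(α | α) = 2` for
the long roots `α`. (On an irreducible root system the invariant form is unique up to a scalar.) -/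
def rootInner (i j : ι) : ℚ :=
  2 * ((P.posRootForm ℤ).posForm (P.rootSpanMem ℤ i) (P.rootSpanMem ℤ j) : ℤ) / (maxLength P : ℚ)

/-- `t_i = 2 / (α_i | α_i)`, which is `1`, `2` or `3` if the root system is irreducible. -/
def tval (i : ι) : ℚ := 2 / rootInner P i i

/-- `min (t_j m, t_i k)` -/
def minT (i : ι) (m : ℕ) (j : ι) (k : ℕ) : ℚ := min (tval P j * m) (tval P i * k)

/-- `B_{im,jk} = 2 min(t_j m, t_i k) - min(t_j m, t_i (k+1)) - min(t_j m, t_i (k-1))`, `k ≥ 1`. -/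
def Bfun (i : ι) (m : ℕ) (j : ι) (k : ℕ+) : ℚ :=
  2 * minT P i m j k - minT P i m j (k + 1) - minT P i m j (k - 1)

/-- The integer `(α_i | α_j) B_{im,jk}`; see `cast_expo` for the integrality. -/
def expo (i : ι) (m : ℕ) (j : ι) (k : ℕ+) : ℤ := ⌊rootInner P i j * Bfun P i m j k⌋

lemma rootLength_le_maxLength (i : ι) : (P.posRootForm ℤ).rootLength i ≤ maxLength P :=
  le_ciSup (f := fun k => (P.posRootForm ℤ).rootLength k) (Set.finite_range _).bddAbove i

lemma tval_eq (i : ι) :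
    tval P i = (maxLength P : ℚ) / ((P.posRootForm ℤ).rootLength i : ℚ) := by
  have h1 := (P.posRootForm ℤ).rootLength_pos i
  have h2 := h1.trans_le (rootLength_le_maxLength P i)
  have h1' : ((P.posRootForm ℤ).rootLength i : ℚ) ≠ 0 := by exact_mod_cast h1.ne'
  have h2' : (maxLength P : ℚ) ≠ 0 := by exact_mod_cast h2.ne'
  change 2 / (2 * ((P.posRootForm ℤ).rootLength i : ℚ) / (maxLength P : ℚ)) = _
  field_simp

lemma rootInner_mul_tval (i j : ι) :
    rootInner P i j * tval P j = (P.pairingIn ℤ i j : ℚ) := by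
  have h1 := (P.posRootForm ℤ).rootLength_pos j
  have h2 := h1.trans_le (rootLength_le_maxLength P j)
  have h1' : ((P.posRootForm ℤ).rootLength j : ℚ) ≠ 0 := by exact_mod_cast h1.ne'
  have h2' : (maxLength P : ℚ) ≠ 0 := by exact_mod_cast h2.ne'
  have key : 2 * (P.posRootForm ℤ).posForm (P.rootSpanMem ℤ i) (P.rootSpanMem ℤ j) =
      P.pairingIn ℤ i j * (P.posRootForm ℤ).rootLength j := by
    apply FaithfulSMul.algebraMap_injective ℤ K
    have h := (P.posRootForm ℤ).toInvariantForm.two_mul_apply_root_root i j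
    rw [map_mul, map_mul, map_ofNat, RootPairing.algebraMap_pairingIn,
      RootPairing.RootPositiveForm.algebraMap_rootLength,
      RootPairing.RootPositiveForm.algebraMap_posForm]
    exact h
  have key' : (2 : ℚ) * ((P.posRootForm ℤ).posForm (P.rootSpanMem ℤ i) (P.rootSpanMem ℤ j) : ℤ) =
      P.pairingIn ℤ i j * ((P.posRootForm ℤ).rootLength j : ℤ) := by exact_mod_cast key
  rw [tval_eq, rootInner, key']
  field_simp

lemma rootInner_comm (i j : ι) : rootInner P i j = rootInner P j i := by
  have := (P.posRootForm ℤ).isSymm_posForm.eq (P.rootSpanMem ℤ i) (P.rootSpanMem ℤ j)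
  simp only [RingHom.id_apply] at this
  rw [rootInner, rootInner, this]

lemma tval_pos (i : ι) : 0 < tval P i := by
  have h1 := (P.posRootForm ℤ).rootLength_pos i
  have h2 := h1.trans_le (rootLength_le_maxLength P i)
  rw [tval_eq]
  have h1' : (0 : ℚ) < ((P.posRootForm ℤ).rootLength i : ℚ) := by exact_mod_cast h1
  have h2' : (0 : ℚ) < (maxLength P : ℚ) := by exact_mod_cast h2
  positivity

lemma tval_mem [P.IsReduced] [P.IsIrreducible] (i : ι) :
    tval P i = 1 ∨ tval P i = 2 ∨ tval P i = 3 := by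
  obtain ⟨l, hl⟩ : ∃ l, (P.posRootForm ℤ).rootLength l = maxLength P := by
    have : Nonempty ι := ⟨i⟩
    exact exists_eq_ciSup_of_finite (f := fun k => (P.posRootForm ℤ).rootLength k)
  obtain ⟨k, hk, hk'⟩ :=
    P.exists_form_eq_form_and_form_ne_zero (P.posRootForm ℤ).toInvariantForm i l
  have hlen : (P.posRootForm ℤ).rootLength k = maxLength P := by
    rw [← hl]
    apply FaithfulSMul.algebraMap_injective ℤ K
    rw [RootPairing.RootPositiveForm.algebraMap_rootLength,
      RootPairing.RootPositiveForm.algebraMap_rootLength]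
    exact hk
  have hne : P.pairingIn ℤ i k ≠ 0 := by
    intro h0
    apply hk'
    rw [(P.posRootForm ℤ).toInvariantForm.apply_root_root_zero_iff]
    rw [← P.algebraMap_pairingIn ℤ, h0, map_zero]
  have hi := (P.posRootForm ℤ).rootLength_pos i
  have hswap := (P.posRootForm ℤ).pairingIn_mul_eq_pairingIn_mul_swap i k
  have hle := rootLength_le_maxLength P i
  rw [hlen] at hswap
  have hi' : ((P.posRootForm ℤ).rootLength i : ℚ) ≠ 0 := by exact_mod_cast hi.ne'
  rw [tval_eq]
  generalize (P.posRootForm ℤ).rootLength i = x at *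
  generalize maxLength P = y at *
  have hy : y = x ∨ y = 2 * x ∨ y = 3 * x := by
    have hmem := P.pairingIn_pairingIn_mem_set_of_isCrystal_of_isRed i k
    generalize P.pairingIn ℤ i k = u at *
    generalize P.pairingIn ℤ k i = v at *
    simp only [Set.mem_insert_iff, Set.mem_singleton_iff, Prod.mk.injEq] at hmem
    rcases hmem with h | h | h | h | h | h | h | h | h | h | h | h | h <;>
      obtain ⟨rfl, rfl⟩ := h <;> omega
  rcases hy with rfl | rfl | rfl
  · left; field_simp
  · right; left; push_cast; field_simp
  · right; right; push_cast; field_simp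

/-- The number in the definition of `expo` is an integer. -/
lemma cast_expo [P.IsReduced] [P.IsIrreducible] (i : ι) (m : ℕ) (j : ι) (k : ℕ+) :
    (expo P i m j k : ℚ) = rootInner P i j * Bfun P i m j k := by
  suffices h : ∃ z : ℤ, rootInner P i j * Bfun P i m j k = z by
    obtain ⟨z, hz⟩ := h
    rw [expo, hz, Int.floor_intCast]
  have h1 := rootInner_mul_tval P i j
  have h2 := rootInner_mul_tval P j i
  rw [rootInner_comm] at h2
  by_cases ht : tval P i = tval P j
  · refine ⟨P.pairingIn ℤ i j * (2 * min (m : ℤ) (k : ℕ) - min (m : ℤ) ((k : ℕ) + 1 : ℕ) -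
      min (m : ℤ) ((k : ℕ) - 1 : ℕ)), ?_⟩
    have hmin : ∀ r : ℕ, minT P i m j r = tval P j * (min (m : ℤ) (r : ℤ) : ℤ) := by
      intro r
      rw [minT, ht, ← mul_min_of_nonneg _ _ (tval_pos P j).le]
      push_cast
      rfl
    rw [Bfun, hmin, hmin, hmin]
    push_cast [← h1]
    ring
  · have hint : ∃ z : ℤ, rootInner P i j = z := by
      rcases tval_mem P i with hi | hi | hi <;> rcases tval_mem P j with hj | hj | hj <;>
        rw [hi] at h2 ht <;> rw [hj] at h1 ht
      · exact absurd rfl ht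
      · exact ⟨P.pairingIn ℤ j i, by linarith⟩
      · exact ⟨P.pairingIn ℤ j i, by linarith⟩
      · exact ⟨P.pairingIn ℤ i j, by linarith⟩
      · exact absurd rfl ht
      · exact ⟨P.pairingIn ℤ i j - P.pairingIn ℤ j i, by push_cast; linarith⟩
      · exact ⟨P.pairingIn ℤ i j, by linarith⟩
      · exact ⟨P.pairingIn ℤ j i - P.pairingIn ℤ i j, by push_cast; linarith⟩
      · exact absurd rfl ht
    have htn : ∀ l : ι, ∃ n : ℤ, tval P l = n := by
      intro l
      rcases tval_mem P l with h | h | h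
      · exact ⟨1, by simpa using h⟩
      · exact ⟨2, by simpa using h⟩
      · exact ⟨3, by simpa using h⟩
    obtain ⟨z, hz⟩ := hint
    obtain ⟨ti, hti⟩ := htn i
    obtain ⟨tj, htj⟩ := htn j
    have hmin : ∀ r : ℕ, ∃ c : ℤ, minT P i m j r = c :=
      fun r => ⟨min (tj * m) (ti * r), by rw [minT, hti, htj]; push_cast; rfl⟩
    obtain ⟨c1, hc1⟩ := hmin k
    obtain ⟨c2, hc2⟩ := hmin (k + 1)
    obtain ⟨c3, hc3⟩ := hmin (k - 1)
    exact ⟨z * (2 * c1 - c2 - c3), by rw [Bfun, hz, hc1, hc2, hc3]; push_cast; rfl⟩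

end Form

section Series

variable {ι K V W : Type*} [Fintype ι] [Field K] [CharZero K] [AddCommGroup V] [Module K V]
  [AddCommGroup W] [Module K W] {P : RootPairing ι K V W} [P.IsCrystallographic] (b : P.Base)

/-- The index set `H` of the pairs `(a, m)`, where `a` is (the index of) a simple root and
`m ∈ {1, 2, …}`. Its finitely supported functions `H b →₀ ℕ` are the elements of `𝒩`. -/
abbrev H : Type _ := b.support × ℕ+

/-- The characterization of the family `(Q̃_m^{(a)}(y))` of invertible power series in the
variables `y_a` (`a` a simple root), with the convention `Q̃_0^{(a)} = 1`. The last clause is the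
existence of the limit in the usual topology of the ring of formal power series, in which a
sequence converges if and only if each of its coefficients is eventually constant. -/
structure IsQFamily (Q : b.support → ℕ → (MvPowerSeries b.support ℂ)ˣ) : Prop where
  zero : ∀ a, Q a 0 = 1
  qsystem : ∀ (a : b.support) (m : ℕ), 1 ≤ m →
    (Q a m : MvPowerSeries b.support ℂ) ^ 2 =
      (Q a (m + 1) : MvPowerSeries b.support ℂ) * (Q a (m - 1) : MvPowerSeries b.support ℂ) +
      MvPowerSeries.X a ^ m * (Q a m : MvPowerSeries b.support ℂ) ^ 2 *
        ((∏ᶠ p : H b, Q p.1 p.2 ^ (-expo P a m p.1 p.2) : (MvPowerSeries b.support ℂ)ˣ) :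
          MvPowerSeries b.support ℂ)
  convergent : ∀ a, ∃ L : MvPowerSeries b.support ℂ, ∀ d : b.support →₀ ℕ,
    ∀ᶠ m in Filter.atTop,
      MvPowerSeries.coeff d (Q a m : MvPowerSeries b.support ℂ) = MvPowerSeries.coeff d L

/-- The binomial coefficient `x (x-1) ⋯ (x-j+1) / j!`. -/
def binom (x : ℚ) (j : ℕ) : ℚ := (∏ i ∈ Finset.range j, (x - i)) / (j ! : ℚ)

/-- `γ_m^{(a)}(ν) = ∑_k min(m,k) ν_k^{(a)}` -/
def gamma {b : P.Base} (ν : H b →₀ ℕ) (p : H b) : ℚ :=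
  open Classical in ν.sum fun q n => if q.1 = p.1 then (min (p.2 : ℕ) (q.2 : ℕ) * n : ℚ) else 0

/-- `P_m^{(a)}(ν,N) = γ_m^{(a)}(ν) - ∑_{(b,k)} (α_a|α_b) min(t_b m, t_a k) N_k^{(b)}` -/
def vacancy {b : P.Base} (ν N : H b →₀ ℕ) (p : H b) : ℚ :=
  gamma ν p - N.sum fun q n => rootInner P p.1 q.1 * minT P p.1 p.2 q.1 q.2 * n

/-- `K(ν,N) = ∏_{(a,m)} binom(P_m^{(a)} + N_m^{(a)}, N_m^{(a)})`; the factors with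
`N_m^{(a)} = 0` are `1`. -/
def Knum {b : P.Base} (ν N : H b →₀ ℕ) : ℚ :=
  ∏ p ∈ N.support, binom (vacancy ν N p + N p) (N p)

/-- The exponent `(∑_m m N_m^{(a)})_a` of `y` attached to `N`. -/
def content {b : P.Base} (N : H b →₀ ℕ) : b.support →₀ ℕ :=
  N.sum fun p n => Finsupp.single p.1 ((p.2 : ℕ) * n)

/-- Only finitely many `N` have a given content. -/
lemma finite_content {b : P.Base} (d : b.support →₀ ℕ) :
    {N : H b →₀ ℕ | content N = d}.Finite := by
  classical
  let s : Finset (H b) := Finset.univ.biUnion fun a =>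
    (Finset.range (d a)).image fun i => (a, Nat.succPNat i)
  let F : H b →₀ ℕ := Finsupp.onFinset s (fun p => if p ∈ s then d p.1 else 0)
    (fun p hp => by by_contra h; simp [h] at hp)
  refine (Set.finite_Iic F).subset ?_
  intro N hN p
  rcases Nat.eq_zero_or_pos (N p) with h0 | hpos
  · simp [h0]
  have hp : p ∈ N.support := by simpa using hpos.ne'
  have hle : (p.2 : ℕ) * N p ≤ d p.1 := by
    have hN' : content N = d := hN
    rw [← hN', content, Finsupp.sum, Finsupp.finsetSum_apply]
    refine le_trans ?_ (Finset.single_le_sum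
      (f := fun q => (Finsupp.single q.1 ((q.2 : ℕ) * N q)) p.1) (fun _ _ => Nat.zero_le _) hp)
    simp
  have h2 : (p.2 : ℕ) ≤ d p.1 := (Nat.le_mul_of_pos_right _ hpos).trans hle
  have hs : p ∈ s := by
    have h1 := p.2.pos
    refine Finset.mem_biUnion.2 ⟨p.1, Finset.mem_univ _, Finset.mem_image.2
      ⟨(p.2 : ℕ) - 1, Finset.mem_range.2 (by omega), Prod.ext rfl (PNat.eq ?_)⟩⟩
    change (p.2 : ℕ) - 1 + 1 = p.2
    omega
  change N p ≤ if p ∈ s then d p.1 else 0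
  rw [if_pos hs]
  exact (Nat.le_mul_of_pos_left _ p.2.pos).trans hle

/-- `K̃^ν(y) = ∑_N K(ν,N) ∏_a y_a^{∑_m m N_m^{(a)}}`; the sum that gives a coefficient is finite
by `finite_content`. -/
def Ktilde {b : P.Base} (ν : H b →₀ ℕ) : MvPowerSeries b.support ℂ :=
  fun d => ∑ᶠ (N : H b →₀ ℕ) (_ : content N = d), (Knum ν N : ℂ)

/-- `Q̃^ν(y) = ∏_{(a,m)} Q̃_m^{(a)}(y)^{ν_m^{(a)}}` -/
def Qtilde {b : P.Base} (Q : b.support → ℕ → (MvPowerSeries b.support ℂ)ˣ) (ν : H b →₀ ℕ) :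
    MvPowerSeries b.support ℂ :=
  ν.prod fun p n => (Q p.1 p.2 : MvPowerSeries b.support ℂ) ^ n

/-- The sum `∑_a d_a α_a` of simple roots. -/
def rootSum {b : P.Base} (d : b.support →₀ ℕ) : V := d.sum fun a n => n • P.root a

/-- A formal sum `∑_λ c_λ e^λ` is represented by its coefficient function `λ ↦ c_λ`. This is
the formal sum `e^μ f(y)|_{y_a = e^{-α_a}}`: its coefficient at `μ - ∑_a d_a α_a` is that of `y^d`
in `f`, and the other coefficients are zero. (There is at most one `d` for each `λ`, since the
simple roots are linearly independent.) -/
def expand (b : P.Base) (μ : V) (f : MvPowerSeries b.support ℂ) : V → ℂ :=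
  fun lam => ∑ᶠ (d : b.support →₀ ℕ) (_ : μ - rootSum d = lam), MvPowerSeries.coeff d f

/-- The invariance of a formal sum `∑_λ c_λ e^λ` under the Weyl group, which acts by
`w (e^λ) = e^{w λ}`. -/
def IsWeylInvariant (P : RootPairing ι K V W) (c : V → ℂ) : Prop :=
  ∀ (w : P.weylGroup) (lam : V), c (w • lam) = c lam

/-- The product of a formal sum of exponentials by a finite one. -/
def mulFinite (c : V → ℂ) (g : AddMonoidAlgebra ℂ V) : V → ℂ :=
  fun lam => g.coeff.sum fun μ z => z * c (lam - μ)

/-- `∏_{α > 0} (1 - e^{-α})`, the product over all positive roots. -/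
def weylDenominator (b : P.Base) : AddMonoidAlgebra ℂ V :=
  open Classical in
  ∏ i : ι with b.IsPos i, (1 - AddMonoidAlgebra.single (-P.root i) (1 : ℂ))

variable [P.IsRootSystem]

/-- The fundamental weights `Λ_a`, i.e. the basis dual to the basis of the simple coroots. -/
def fundWeight {b : P.Base} (a : b.support) : V :=
  P.toPerfPair.symm (b.toCoweightBasis.coord a)

lemma toLinearMap_fundWeight {b : P.Base} (a c : b.support) [Decidable (a = c)] :
    P.toLinearMap (fundWeight a) (P.coroot c) = if a = c then 1 else 0 := by
  have h : P.toLinearMap (fundWeight a) = b.toCoweightBasis.coord a :=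
    P.toPerfPair.apply_symm_apply _
  classical
  rw [h, Module.Basis.coord_apply, RootPairing.Base.toCoweightBasis_repr_coroot,
    Finsupp.single_apply]
  by_cases hac : a = c
  · rw [if_pos hac, if_pos hac.symm]
  · rw [if_neg hac, if_neg (Ne.symm hac)]

/-- The weight `∑_{(a,m)} m ν_m^{(a)} Λ_a`. -/
def weight {b : P.Base} (ν : H b →₀ ℕ) : V :=
  ν.sum fun p n => ((p.2 : ℕ) * n) • fundWeight p.1

/-- `Q_m^{(a)}(x) = x_a^m Q̃_m^{(a)}(y(x))`, with `x_a = e^{Λ_a}` and `y_a = e^{-α_a}`. -/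
def Qx {b : P.Base} (Q : b.support → ℕ → (MvPowerSeries b.support ℂ)ˣ) (a : b.support) (m : ℕ) :
    V → ℂ :=
  expand b (m • fundWeight a) (Q a m : MvPowerSeries b.support ℂ)

/-- `Q^ν(x) = ∏_{(a,m)} Q_m^{(a)}(x)^{ν_m^{(a)}} = (∏_{(a,m)} x_a^{m ν_m^{(a)}}) Q̃^ν(y(x))` -/
def Qnu {b : P.Base} (Q : b.support → ℕ → (MvPowerSeries b.support ℂ)ˣ) (ν : H b →₀ ℕ) : V → ℂ :=
  expand b (weight ν) (Qtilde Q ν)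

/-- `K^ν(x) = (∏_{(a,m)} x_a^{m ν_m^{(a)}}) K̃^ν(y(x))` -/
def Kx {b : P.Base} (ν : H b →₀ ℕ) : V → ℂ := expand b (weight ν) (Ktilde ν)

/-- `k^ν_λ`, the coefficient of `e^λ` in `Q^ν(x) ∏_{α > 0} (1 - e^{-α})`. -/
def kcoeff {b : P.Base} (Q : b.support → ℕ → (MvPowerSeries b.support ℂ)ˣ) (ν : H b →₀ ℕ)
    (lam : V) : ℂ :=
  mulFinite (Qnu Q ν) (weylDenominator b) lam

/-- `𝒩^ν_λ = {N ∈ 𝒩 | ∑ m ν_m^{(a)} Λ_a - ∑ m N_m^{(a)} α_a = λ}` -/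
def Nset {b : P.Base} (ν : H b →₀ ℕ) (lam : V) : Set (H b →₀ ℕ) :=
  {N | weight ν - (N.sum fun p n => ((p.2 : ℕ) * n) • P.root p.1) = lam}

end Series

end QSystem

end

set_option linter.unusedSectionVars false

noncomputable section

namespace QSystem

/-! ### Binomial identities. -/

section Binomial

/-! Write `G` for the matrix `(α_a|α_b) min(t_b m, t_a k)` and `z_m^{(a)} = Q̃_{m+1} Q̃_{m-1} /
Q̃_m²`. Convergence in `m` lets the second differences be inverted: `Q̃_m^{(a)} = ∏_k
(z_k^{(a)})^{-min(m,k)}`. The Q-system becomes `1 - z_i = y^{c_i} z^{G_i}`, with `y^{c_i} = y_a^m`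
for `i = (a,m)` (`one_sub_zTrunc_eq`). All of this takes place modulo degree `> M`, where only
finitely many `z_i` differ from `1`.

Let `S(x)` be the fermionic series with vacancies shifted by `x`. Pascal's rule gives `S(x) - S(x -
e_i) = y^{c_i} S(x - G_i)`, so `S(x) z^x` does not depend on `x` (`twistedSeries_eq`); hence `K̃^ν =
Q̃^ν K̃^0` (`Ktilde_eq_Qtilde_mul`). The same invariance, with a determinant identity for binomials,
gives `K̃^0 · ∏ z_j · det(1 + G(z⁻¹ - 1)) = 1` (`truncHom_Ktilde_zero_mul_det`).

Differentiating `1 - z_i = y^{c_i} z^{G_i}` logarithmically and comparing with this determinant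
identifies `K̃^0` with the Jacobian determinant of `Q_1^{(1)}(x), …, Q_1^{(n)}(x)`, stripped of its
factor `e^ρ` (`det_jacobianMatrix`).

If the `Q_1^{(a)}(x)` are Weyl invariant, they are finite sums, and a simple reflection multiplies
their Jacobian matrix by a matrix of determinant `-1`; so `e^ρ K^0` is antiinvariant
(`exists_coe_eq_det_jacobianMatrix`). So is `e^ρ ∏(1 - e^{-α})`, with the same leading coefficient
`1`, and an antiinvariant supported strictly below `ρ` vanishes (`eq_zero_of_antiinvariant`). This
gives `K^0`, and multiplying by `Q^ν` gives the formula for `k^ν_λ`. -/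

lemma binom_zero (x : ℚ) : binom x 0 = 1 := by simp [binom]

lemma binom_eq_sub_one_add (x : ℚ) (n : ℕ) :
    binom x (n + 1) = binom (x - 1) (n + 1) + binom (x - 1) n := by
  have h1 : ∏ i ∈ Finset.range (n + 1), (x - (i : ℕ)) =
      x * ∏ i ∈ Finset.range n, (x - 1 - (i : ℕ)) := by
    rw [Finset.prod_range_succ', mul_comm]
    congr 1
    · simp
    · exact Finset.prod_congr rfl fun i _ => by push_cast; ring
  have h0 : (n ! : ℚ) ≠ 0 := by exact_mod_cast n.factorial_ne_zero
  have h2 : ((n : ℚ) + 1) ≠ 0 := by positivity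
  rw [binom, binom, binom, h1, Finset.prod_range_succ, Nat.factorial_succ]
  push_cast
  field_simp
  ring

lemma succ_mul_binom_succ (x : ℚ) (n : ℕ) :
    (n + 1 : ℚ) * binom x (n + 1) = (x - n) * binom x n := by
  have h0 : (n ! : ℚ) ≠ 0 := by exact_mod_cast n.factorial_ne_zero
  have h2 : ((n : ℚ) + 1) ≠ 0 := by positivity
  rw [binom, binom, Finset.prod_range_succ, Nat.factorial_succ]
  push_cast
  field_simp

/-- This is column `j` of the statement that `N` is a left null vector in `sum_det_mul_fermTerm`,
with `n = N j` and `p = (G N)_j`. -/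
lemma binom_kernel_relation (p : ℚ) (n : ℕ) :
    n * binom (-1 - p + n) n + p * (binom (-p + n) n - binom (-1 - p + n) n) = 0 := by
  cases n with
  | zero => simp [binom_zero]
  | succ k =>
    have h1 := binom_eq_sub_one_add (-p + (k + 1 : ℕ)) k
    have h2 := succ_mul_binom_succ (-1 - p + (k + 1 : ℕ)) k
    rw [show -p + ((k + 1 : ℕ) : ℚ) - 1 = -1 - p + (k + 1 : ℕ) by ring] at h1
    rw [h1]
    push_cast at h2 ⊢
    rw [h2]
    ring

end Binomial

/-! ### Two determinant expansions. -/

section Determinant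

variable {n R : Type*} [Fintype n] [DecidableEq n] [CommRing R]

/-- Expansion of the determinant of a matrix whose columns are combinations of the columns of two
matrices. -/
lemma det_columns_combination (A B : Matrix n n R) (r s : n → R) :
    (Matrix.of fun i j => A i j * r j + B i j * s j).det =
      ∑ X : Finset n, (Matrix.of fun i j => if j ∈ X then B i j else A i j).det *
        ∏ j, if j ∈ X then s j else r j := by
  simp only [Matrix.det_apply', Matrix.of_apply]
  simp_rw [Finset.sum_mul]
  rw [Finset.sum_comm]
  refine Finset.sum_congr rfl fun σ _ => ?_
  simp_rw [add_comm (A _ _ * r _), Fintype.prod_add, Finset.mul_sum]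
  refine Finset.sum_congr rfl fun X _ => ?_
  rw [mul_assoc, ← Finset.prod_mul_distrib]
  congr 1
  rw [← Finset.prod_mul_prod_compl X]
  congr 1
  · exact Finset.prod_congr rfl fun j hj => by simp [hj]
  · exact Finset.prod_congr rfl fun j hj => by simp [Finset.mem_compl.1 hj]

/-- A matrix `1 + N` with `N` strictly triangular for a grading of the indices has determinant
`1`. -/
lemma det_one_add_of_strictly_triangular {α : Type*} [LinearOrder α] (N : Matrix n n R)
    (g : n → α) (h : ∀ i j, g i ≤ g j → N i j = 0) : (1 + N).det = 1 := by
  have hT : (1 + N).BlockTriangular (fun i => OrderDual.toDual (g i)) := by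
    intro i j hij
    have hij' : g i < g j := hij
    rw [Matrix.add_apply, h i j hij'.le, Matrix.one_apply_ne, add_zero]
    rintro rfl
    exact lt_irrefl _ hij'
  rw [hT.det]
  refine Finset.prod_eq_one fun a _ => ?_
  have : (1 + N).toSquareBlock (fun i => OrderDual.toDual (g i)) a = 1 := by
    ext i j
    have hi : OrderDual.toDual (g i) = a := i.2
    have hj : OrderDual.toDual (g j) = a := j.2
    have hij : g i = g j := OrderDual.toDual.injective (hi.trans hj.symm)
    rw [Matrix.toSquareBlock_def, Matrix.of_apply, Matrix.add_apply, h i j hij.le, add_zero,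
      Matrix.one_apply, Matrix.one_apply]
    simp [Subtype.ext_iff]
  rw [this, Matrix.det_one]

end Determinant

/-! ### Power series modulo high degree. -/

section Truncation

variable (σ : Type*)

/-- The ideal of the power series without terms of degree less than `k`. -/
def orderIdeal (k : ℕ) : Ideal (MvPowerSeries σ ℂ) where
  carrier := {f | (k : ℕ∞) ≤ f.order}
  add_mem' {f g} hf hg := (le_min hf hg).trans MvPowerSeries.min_order_le_add
  zero_mem' := by simp
  smul_mem' c f hf := (le_trans hf le_add_self).trans MvPowerSeries.le_order_mul

variable {σ}

lemma mem_orderIdeal {k : ℕ} {f : MvPowerSeries σ ℂ} :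
    f ∈ orderIdeal σ k ↔ ∀ d : σ →₀ ℕ, d.degree < k → MvPowerSeries.coeff d f = 0 := by
  constructor
  · intro h d hd
    exact MvPowerSeries.coeff_of_lt_order (lt_of_lt_of_le (by exact_mod_cast hd) h)
  · exact fun h => MvPowerSeries.nat_le_order h

lemma mul_mem_orderIdeal {k l : ℕ} {f g : MvPowerSeries σ ℂ} (hf : f ∈ orderIdeal σ k)
    (hg : g ∈ orderIdeal σ l) : f * g ∈ orderIdeal σ (k + l) := by
  have h : ((k + l : ℕ) : ℕ∞) ≤ f.order + g.order := by
    push_cast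
    exact add_le_add hf hg
  exact h.trans MvPowerSeries.le_order_mul

lemma monomial_mem_orderIdeal {k : ℕ} {d : σ →₀ ℕ} (h : k ≤ d.degree) (c : ℂ) :
    MvPowerSeries.monomial d c ∈ orderIdeal σ k := by
  classical
  rw [mem_orderIdeal]
  intro e he
  rw [MvPowerSeries.coeff_monomial, if_neg]
  rintro rfl
  omega

variable (σ) in
/-- The ring of power series truncated above degree `M`. -/
def TruncRing (M : ℕ) : Type _ := MvPowerSeries σ ℂ ⧸ orderIdeal σ (M + 1)

instance (M : ℕ) : CommRing (TruncRing σ M) :=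
  inferInstanceAs (CommRing (MvPowerSeries σ ℂ ⧸ orderIdeal σ (M + 1)))

variable (σ) in
/-- The truncation above degree `M`. -/
def truncHom (M : ℕ) : MvPowerSeries σ ℂ →+* TruncRing σ M :=
  Ideal.Quotient.mk (orderIdeal σ (M + 1))

lemma truncHom_surjective (M : ℕ) : Function.Surjective (truncHom σ M) :=
  Ideal.Quotient.mk_surjective

lemma truncHom_eq_iff {M : ℕ} {f g : MvPowerSeries σ ℂ} :
    truncHom σ M f = truncHom σ M g ↔
      ∀ d : σ →₀ ℕ, d.degree ≤ M → MvPowerSeries.coeff d f = MvPowerSeries.coeff d g := by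
  refine Ideal.Quotient.eq.trans ?_
  rw [mem_orderIdeal]
  simp only [map_sub, sub_eq_zero, Nat.lt_succ_iff]

lemma eq_of_truncHom_eq {f g : MvPowerSeries σ ℂ}
    (h : ∀ M, truncHom σ M f = truncHom σ M g) : f = g :=
  MvPowerSeries.ext fun d => truncHom_eq_iff.1 (h d.degree) d le_rfl

lemma truncHom_monomial_eq_zero {M : ℕ} {d : σ →₀ ℕ} (h : M < d.degree) (c : ℂ) :
    truncHom σ M (MvPowerSeries.monomial d c) = 0 :=
  Ideal.Quotient.eq_zero_iff_mem.2 (monomial_mem_orderIdeal h c)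

end Truncation

/-! ### Fermionic series with shifted vacancies, and Pascal's rule. -/

section FermionicSeries

variable {I σ : Type*} (c : (I →₀ ℕ) →+ (σ →₀ ℕ)) (hc : ∀ d, {N | c N = d}.Finite)
  (G : I → I → ℤ)

/-- `∑_q G_{pq} N_q` -/
def pairSum (N : I →₀ ℕ) (p : I) : ℤ := N.sum fun q n => G p q * n

lemma pairSum_add_single (N : I →₀ ℕ) (i p : I) :
    pairSum G (N + Finsupp.single i 1) p = pairSum G N p + G p i := by
  classical
  rw [pairSum, Finsupp.sum_add_index' (by simp) (by intros; push_cast; ring)]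
  simp [pairSum]

/-- The product of binomial coefficients attached to `N` and to the (shifted) vacancies. -/
def fermTerm (x : I → ℤ) (N : I →₀ ℕ) : ℚ :=
  ∏ p ∈ N.support, binom ((x p - pairSum G N p : ℤ) + N p) (N p)

lemma fermTerm_eq_prod {F : Finset I} {N : I →₀ ℕ} (h : N.support ⊆ F) (x : I → ℤ) :
    fermTerm G x N = ∏ p ∈ F, binom ((x p - pairSum G N p : ℤ) + N p) (N p) := by
  refine Finset.prod_subset h fun p _ hp => ?_
  rw [Finsupp.notMem_support_iff.1 hp, binom_zero]

lemma fermTerm_congr {F : Finset I} {N : I →₀ ℕ} (h : N.support ⊆ F) {x x' : I → ℤ}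
    (hx : ∀ p ∈ F, x p = x' p) : fermTerm G x N = fermTerm G x' N :=
  Finset.prod_congr rfl fun p hp => by rw [hx p (h hp)]

/-- Pascal's rule in the factor `i`. Adding one to `N i` changes the pairing at `p` by `G p i`,
which is absorbed into the shift; the factors at `p ≠ i` do not see the subtraction of `Pi.single i
1`. -/
lemma fermTerm_sub [DecidableEq I] (x : I → ℤ) (N : I →₀ ℕ) (i : I) :
    fermTerm G x (N + Finsupp.single i 1) -
      fermTerm G (x - Pi.single i 1) (N + Finsupp.single i 1) =
      fermTerm G (fun p => x p - G p i) N := by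
  have h1 : (N + Finsupp.single i 1).support ⊆ insert i N.support := by
    intro p hp
    by_contra h
    simp only [Finset.mem_insert, not_or, Finsupp.notMem_support_iff] at h
    simp [Finsupp.single_eq_of_ne h.1, h.2] at hp
  have h2 : N.support ⊆ insert i N.support := Finset.subset_insert _ _
  rw [fermTerm_eq_prod G h1, fermTerm_eq_prod G h1, fermTerm_eq_prod G h2,
    ← Finset.mul_prod_erase _ _ (Finset.mem_insert_self i N.support),
    ← Finset.mul_prod_erase _ _ (Finset.mem_insert_self i N.support),
    ← Finset.mul_prod_erase _ _ (Finset.mem_insert_self i N.support)]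
  have e1 : ∀ y : I → ℤ, (∀ p, p ≠ i → y p = x p) →
      ∏ p ∈ (insert i N.support).erase i,
        binom ((y p - pairSum G (N + Finsupp.single i 1) p : ℤ) +
          ((N + Finsupp.single i 1 : I →₀ ℕ) p : ℕ)) ((N + Finsupp.single i 1 : I →₀ ℕ) p) =
      ∏ p ∈ (insert i N.support).erase i,
        binom ((x p - G p i - pairSum G N p : ℤ) + N p) (N p) := by
    intro y hy
    refine Finset.prod_congr rfl fun p hp => ?_
    have hpi := Finset.ne_of_mem_erase hp
    rw [hy p hpi, pairSum_add_single]
    simp only [Finsupp.add_apply, Finsupp.single_eq_of_ne hpi, add_zero]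
    congr 3
    ring
  rw [e1 x fun _ _ => rfl, e1 (x - Pi.single i 1) fun p hp => by simp [hp], ← sub_mul]
  congr 1
  simp only [Finsupp.add_apply, Finsupp.single_eq_same, pairSum_add_single, Pi.sub_apply,
    Pi.single_eq_same]
  rw [binom_eq_sub_one_add]
  push_cast
  ring_nf

/-- The generating series of the numbers `fermTerm`. -/
def fermSeries (x : I → ℤ) : MvPowerSeries σ ℂ :=
  fun d => ∑ᶠ (N : I →₀ ℕ) (_ : c N = d), (fermTerm G x N : ℂ)

include hc

lemma coeff_fermSeries (x : I → ℤ) (d : σ →₀ ℕ) :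
    MvPowerSeries.coeff d (fermSeries c G x) = ∑ N ∈ (hc d).toFinset, (fermTerm G x N : ℂ) := by
  change ∑ᶠ (N : I →₀ ℕ) (_ : c N = d), (fermTerm G x N : ℂ) = _
  exact finsum_mem_eq_finite_toFinset_sum (s := {N | c N = d}) _ (hc d)

/-- `fermTerm_sub` summed over `N`: the terms with `N i = 0` cancel, and the others are reindexed by
removing one from `N i`. -/
lemma fermSeries_sub [DecidableEq I] (x : I → ℤ) (i : I) :
    fermSeries c G x - fermSeries c G (x - Pi.single i 1) =
      MvPowerSeries.monomial (c (Finsupp.single i 1)) 1 *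
        fermSeries c G (fun p => x p - G p i) := by
  classical
  ext d
  rw [map_sub, coeff_fermSeries c hc, coeff_fermSeries c hc, MvPowerSeries.coeff_monomial_mul,
    ← Finset.sum_sub_distrib]
  have h0 : ∀ N : I →₀ ℕ, N i = 0 →
      (fermTerm G x N : ℂ) - (fermTerm G (x - Pi.single i 1) N : ℂ) = 0 := by
    intro N hN
    rw [fermTerm, fermTerm, sub_eq_zero]
    congr 1
    refine Finset.prod_congr rfl fun p hp => ?_
    have : p ≠ i := by
      rintro rfl
      simp [hN] at hp
    simp [this]
  split_ifs with hle
  · rw [one_mul, coeff_fermSeries c hc]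
    symm
    refine Finset.sum_of_injOn (fun N => N + Finsupp.single i 1) ?_ ?_ ?_ ?_
    · intro a _ b _ h
      exact add_right_cancel h
    · intro N hN
      simp only [Set.Finite.coe_toFinset, Set.mem_ofPred_eq] at hN ⊢
      rw [map_add, hN, tsub_add_cancel_of_le hle]
    · intro N hN hN'
      apply h0
      by_contra hi
      apply hN'
      have hs : N - Finsupp.single i 1 + Finsupp.single i 1 = N :=
        tsub_add_cancel_of_le (Finsupp.single_le_iff.2 (Nat.one_le_iff_ne_zero.2 hi))
      refine ⟨N - Finsupp.single i 1, ?_, hs⟩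
      simp only [Set.Finite.coe_toFinset, Set.Finite.mem_toFinset, Set.mem_ofPred_eq] at hN ⊢
      rw [eq_tsub_iff_add_eq_of_le hle, ← map_add, hs, hN]
    · intro N _
      rw [← fermTerm_sub]
      push_cast
      rfl
  · refine Finset.sum_eq_zero fun N hN => h0 N ?_
    by_contra hi
    apply hle
    have hs : N - Finsupp.single i 1 + Finsupp.single i 1 = N :=
      tsub_add_cancel_of_le (Finsupp.single_le_iff.2 (Nat.one_le_iff_ne_zero.2 hi))
    simp only [Set.Finite.mem_toFinset, Set.mem_ofPred_eq] at hN
    rw [← hN, ← hs, map_add]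
    exact le_add_self

omit hc in
lemma support_subset_of_degree_le {F : Finset I} {M : ℕ}
    (hF : ∀ i, i ∉ F → M < (c (Finsupp.single i 1)).degree) {N : I →₀ ℕ}
    (hN : (c N).degree ≤ M) : N.support ⊆ F := by
  classical
  intro i hi
  by_contra h
  have h1 := hF i h
  have hs : N - Finsupp.single i 1 + Finsupp.single i 1 = N :=
    tsub_add_cancel_of_le (Finsupp.single_le_iff.2
      (Nat.one_le_iff_ne_zero.2 (Finsupp.mem_support_iff.1 hi)))
  rw [← hs, map_add, map_add] at hN
  omega

lemma truncHom_fermSeries_congr {F : Finset I} {M : ℕ}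
    (hF : ∀ i, i ∉ F → M < (c (Finsupp.single i 1)).degree) {x x' : I → ℤ}
    (hx : ∀ p ∈ F, x p = x' p) :
    truncHom σ M (fermSeries c G x) = truncHom σ M (fermSeries c G x') := by
  rw [truncHom_eq_iff]
  intro d hd
  rw [coeff_fermSeries c hc, coeff_fermSeries c hc]
  refine Finset.sum_congr rfl fun N hN => ?_
  simp only [Set.Finite.mem_toFinset, Set.mem_ofPred_eq] at hN
  rw [fermTerm_congr G (support_subset_of_degree_le c hF (by rwa [hN])) hx]

end FermionicSeries

/-! ### Functions on a lattice invariant under unit steps. -/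

section Constancy

variable {I A : Type*} [DecidableEq I]

lemma eq_of_forall_sub_single {F : Finset I} {f : (I → ℤ) → A}
    (hf : ∀ x, ∀ i ∈ F, f x = f (x - Pi.single i 1))
    (hF : ∀ x x' : I → ℤ, (∀ i ∈ F, x i = x' i) → f x = f x') (x x' : I → ℤ) :
    f x = f x' := by
  have h1 : ∀ x, ∀ i ∈ F, ∀ n : ℤ, f (x + Pi.single i n) = f x := by
    intro x i hi n
    induction n using Int.induction_on with
    | zero => simp
    | succ n ih =>
      rw [hf _ i hi, ← ih]
      congr 1
      rw [Pi.single_add]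
      abel
    | pred n ih =>
      have h := hf (x + Pi.single i (-(n : ℤ))) i hi
      rw [← ih, h]
      congr 1
      rw [Pi.single_sub]
      abel
  have h2 : ∀ F' ⊆ F, f (fun i => if i ∈ F' then x' i else x i) = f x := by
    intro F'
    induction F' using Finset.induction_on with
    | empty => simp
    | insert a s ha ih =>
      intro hs
      rw [← ih ((Finset.subset_insert _ _).trans hs),
        ← h1 (fun i => if i ∈ s then x' i else x i) a (hs (Finset.mem_insert_self a s))
          (x' a - x a)]
      congr 1
      funext i
      by_cases hia : i = a
      · subst hia
        simp [ha]
      · simp [hia]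
  rw [← h2 F subset_rfl]
  exact hF _ _ fun i hi => by simp [hi]

end Constancy

/-! ### Independence of the shift, and the determinant formula for the unshifted series. -/

section Inversion

variable {I σ : Type*} [DecidableEq I] (c : (I →₀ ℕ) →+ (σ →₀ ℕ))
  (hc : ∀ d, {N | c N = d}.Finite) (G : I → I → ℤ) {M : ℕ} (F : Finset I)
  (z : I → (TruncRing σ M)ˣ)

/-- The unit `∏_j z_j^{x_j}`. -/
def zMonomial (x : I → ℤ) : (TruncRing σ M)ˣ := ∏ j ∈ F, z j ^ x j

omit [DecidableEq I] in
lemma zMonomial_add (x y : I → ℤ) : zMonomial F z (x + y) = zMonomial F z x * zMonomial F z y := by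
  simp [zMonomial, zpow_add, Finset.prod_mul_distrib]

lemma zMonomial_single {i : I} (hi : i ∈ F) : zMonomial F z (Pi.single i 1) = z i := by
  rw [zMonomial, Finset.prod_eq_single i]
  · simp
  · intro j _ hj
    simp [hj]
  · exact fun h => absurd hi h

/-- The product of the truncated series `fermSeries` and of a monomial in the `z_j`. -/
def twistedSeries (x : I → ℤ) : TruncRing σ M :=
  truncHom σ M (fermSeries c G x) * (zMonomial F z x : (TruncRing σ M)ˣ)

variable {c G F z}

include hc

/-- Writing `T(x) = S(x) z^x`, multiplication of Pascal's rule by `z^x` gives `T(x) - z_i T(x - e_i)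
= (1 - z_i) T(x - G_i)`, since `y^{c_i} z^{G_i} = 1 - z_i`. The right side in this form contains a
difference of values of `T` times an element of positive order. -/
lemma twistedSeries_sub (hG : ∀ i j, G i j = G j i)
    (hz : ∀ i ∈ F, (1 - z i : TruncRing σ M) =
      truncHom σ M (MvPowerSeries.monomial (c (Finsupp.single i 1)) 1) *
        (zMonomial F z (G i) : (TruncRing σ M)ˣ)) (x : I → ℤ) {i : I} (hi : i ∈ F) :
    twistedSeries c G F z x - twistedSeries c G F z (x - Pi.single i 1) =
      (1 - z i : TruncRing σ M) * (twistedSeries c G F z (fun p => x p - G p i) -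
        twistedSeries c G F z (x - Pi.single i 1)) := by
  have h1 := congrArg (truncHom σ M) (fermSeries_sub c hc G x i)
  rw [map_mul, map_sub] at h1
  have h2 : (zMonomial F z x : (TruncRing σ M)ˣ) = zMonomial F z (x - Pi.single i 1) * z i := by
    rw [← zMonomial_single F z hi, ← zMonomial_add, sub_add_cancel]
  have h3 : (zMonomial F z x : (TruncRing σ M)ˣ) =
      zMonomial F z (fun p => x p - G p i) * zMonomial F z (G i) := by
    rw [← zMonomial_add]
    congr 1
    funext p
    simp [hG i p]
  have h2' := congrArg (Units.val) h2
  have h3' := congrArg (Units.val) h3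
  rw [Units.val_mul] at h2' h3'
  have hzi := hz i hi
  simp only [twistedSeries]
  generalize truncHom σ M (fermSeries c G (x - Pi.single i 1)) = s1 at *
  generalize truncHom σ M (fermSeries c G x) = s0 at *
  generalize truncHom σ M (fermSeries c G (fun p => x p - G p i)) = s2 at *
  generalize truncHom σ M (MvPowerSeries.monomial (c (Finsupp.single i 1)) 1) = w at *
  generalize ((zMonomial F z (x - Pi.single i 1) : (TruncRing σ M)ˣ) : TruncRing σ M) = b1 at *
  generalize ((zMonomial F z x : (TruncRing σ M)ˣ) : TruncRing σ M) = b0 at *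
  generalize ((zMonomial F z (fun p => x p - G p i) : (TruncRing σ M)ˣ) : TruncRing σ M) = b2 at *
  generalize ((zMonomial F z (G i) : (TruncRing σ M)ˣ) : TruncRing σ M) = g at *
  generalize ((z i : (TruncRing σ M)ˣ) : TruncRing σ M) = y at *
  linear_combination b0 * h1 + s1 * h2' + s2 * w * h3' - s2 * b2 * hzi

/-- A contraction argument: if all differences of values have order at least `k`, then by
`twistedSeries_sub` unit steps in `F` change the value only in order `k + 1`. Coordinates outside
`F` are invisible modulo degree `> M`, so all differences have order at least `k + 1`, and finally
they vanish. -/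
lemma twistedSeries_eq (hG : ∀ i j, G i j = G j i)
    (hpos : ∀ i, 0 < (c (Finsupp.single i 1)).degree)
    (hF : ∀ i, i ∉ F → M < (c (Finsupp.single i 1)).degree)
    (hz : ∀ i ∈ F, (1 - z i : TruncRing σ M) =
      truncHom σ M (MvPowerSeries.monomial (c (Finsupp.single i 1)) 1) *
        (zMonomial F z (G i) : (TruncRing σ M)ˣ)) (x x' : I → ℤ) :
    twistedSeries c G F z x = twistedSeries c G F z x' := by
  have key : ∀ k : ℕ, ∀ x x' : I → ℤ, twistedSeries c G F z x - twistedSeries c G F z x' ∈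
      (orderIdeal σ k).map (truncHom σ M) := by
    intro k
    induction k with
    | zero =>
      intro x x'
      have h : orderIdeal σ 0 = ⊤ :=
        (Ideal.eq_top_iff_one _).2 (mem_orderIdeal.2 fun d hd => absurd hd (Nat.not_lt_zero _))
      rw [h, Ideal.map_top]
      trivial
    | succ k ih =>
      intro x x'
      rw [← Ideal.Quotient.eq]
      refine eq_of_forall_sub_single (F := F)
        (f := fun x => Ideal.Quotient.mk ((orderIdeal σ (k + 1)).map (truncHom σ M))
          (twistedSeries c G F z x)) ?_ ?_ x x'
      · intro y i hi
        rw [Ideal.Quotient.eq, twistedSeries_sub hc hG hz y hi]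
        obtain ⟨f, hf, hf'⟩ := (Ideal.mem_map_iff_of_surjective _
          (truncHom_surjective M)).1 (ih (fun p => y p - G p i) (y - Pi.single i 1))
        obtain ⟨g, hg⟩ := truncHom_surjective M
          ((zMonomial F z (G i) : (TruncRing σ M)ˣ) : TruncRing σ M)
        rw [← hf', hz i hi, ← hg, mul_assoc, mul_comm, ← map_mul, ← map_mul]
        refine Ideal.mem_map_of_mem _ (mul_mem_orderIdeal (Ideal.mul_mem_left _ _ hf) ?_)
        exact monomial_mem_orderIdeal (hpos i) 1
      · intro y y' hy
        congr 1
        rw [twistedSeries, twistedSeries, truncHom_fermSeries_congr c hc G hF hy]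
        congr 2
        exact Finset.prod_congr rfl fun j hj => by rw [hy j hj]
  have h := key (M + 1) x x'
  have h0 : (orderIdeal σ (M + 1)).map (truncHom σ M) = ⊥ := Ideal.map_quotient_self _
  rwa [h0, Ideal.mem_bot, sub_eq_zero] at h

omit hc in
-- By `det_columns_combination` the sum is one determinant, with columns `(δ_ij - G_ij) r_j + G_ij
-- s_j`, where `r_j`, `s_j` are the binomials with shifts `-1` and `0`. For `N ≠ 0` the vector `N`
-- is in its left kernel; for `N = 0` the matrix is the identity.
lemma sum_det_mul_fermTerm (hG : ∀ i j, G i j = G j i) {N : I →₀ ℕ} (hN : N.support ⊆ F) :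
    ∑ X : Finset F, ((Matrix.of fun i j : F => if j ∈ X then G i j else
        (if i = j then 1 else 0) - G i j).det : ℚ) *
      fermTerm G (fun p => if p ∈ X.map (Function.Embedding.subtype _) then 0 else -1) N =
    if N = 0 then 1 else 0 := by
  have h1 : ∀ X : Finset F,
      fermTerm G (fun p => if p ∈ X.map (Function.Embedding.subtype _) then 0 else -1) N =
      ∏ j : F, if j ∈ X then binom (-(pairSum G N j : ℤ) + N j) (N j) else
        binom (-1 - (pairSum G N j : ℤ) + N j) (N j) := by
    intro X
    rw [fermTerm_eq_prod G hN, ← Finset.prod_coe_sort]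
    refine Finset.prod_congr rfl fun j _ => ?_
    have : ((j : I) ∈ X.map (Function.Embedding.subtype (· ∈ F))) ↔ j ∈ X := by simp
    by_cases hj : j ∈ X
    · rw [if_pos (this.2 hj), if_pos hj]
      push_cast
      ring_nf
    · rw [if_neg (mt this.1 hj), if_neg hj]
      push_cast
      ring_nf
  have h2 := det_columns_combination
    (Matrix.of fun i j : F => (((if i = j then 1 else 0) - G i j : ℤ) : ℚ))
    (Matrix.of fun i j : F => (G i j : ℚ))
    (fun j => binom (-1 - (pairSum G N j : ℤ) + N j) (N j))
    (fun j => binom (-(pairSum G N j : ℤ) + N j) (N j))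
  have h3 : ∀ X : Finset F, ((Matrix.of fun i j : F => if j ∈ X then G i j else
        (if i = j then 1 else 0) - G i j).det : ℚ) =
      (Matrix.of fun i j : F => if j ∈ X then (Matrix.of fun i j : F => (G i j : ℚ)) i j else
        (Matrix.of fun i j : F => (((if i = j then 1 else 0) - G i j : ℤ) : ℚ)) i j).det := by
    intro X
    rw [Int.cast_det]
    congr 1
    ext i j
    simp only [Matrix.map_apply, Matrix.of_apply]
    split_ifs <;> rfl
  simp_rw [h1, h3]
  rw [← h2]
  split_ifs with h0
  · subst h0
    refine (congrArg Matrix.det ?_).trans Matrix.det_one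
    ext i j
    simp [binom_zero, Matrix.one_apply]
  -- `∑_i N_i ((δ_ij - G_ij) r_j + G_ij s_j) = N_j r_j + (G N)_j (s_j - r_j)`, by symmetry of `G`;
  -- this is zero by `binom_kernel_relation`.
  · rw [← Matrix.exists_vecMul_eq_zero_iff]
    refine ⟨fun i => (N i : ℚ), ?_, ?_⟩
    · intro h
      apply h0
      ext i
      by_cases hi : i ∈ F
      · have := congrFun h ⟨i, hi⟩
        simpa using this
      · simpa using fun h => hi (hN (Finsupp.mem_support_iff.2 h))
    · funext j
      have hp : (pairSum G N j : ℚ) = ∑ i : F, (N i : ℚ) * G i j := by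
        rw [pairSum, Finsupp.sum_of_support_subset N hN _ (by simp), ← Finset.sum_coe_sort]
        push_cast
        exact Finset.sum_congr rfl fun i _ => by rw [hG, mul_comm]
      have hk := binom_kernel_relation (pairSum G N j : ℤ) (N j)
      simp only [Matrix.vecMul, dotProduct, Matrix.of_apply, Pi.zero_apply]
      rw [← hk]
      generalize binom (-1 - (pairSum G N j : ℚ) + N j) (N j) = r
      generalize binom (-(pairSum G N j : ℚ) + N j) (N j) = s
      have e : ∀ i : F, (N i : ℚ) * ((((if i = j then 1 else 0) - G i j : ℤ) : ℚ) * r + G i j * s) =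
          (if i = j then (N i : ℚ) * r else 0) + (N i * G i j) * (s - r) := by
        intro i
        split_ifs <;> push_cast <;> ring
      rw [Finset.sum_congr rfl fun i _ => e i, Finset.sum_add_distrib, ← Finset.sum_mul, ← hp]
      simp

/-- Let `y_X` be the shift `0` on `X` and `-1` off `X`. Shift independence gives `S(y_X) = S(0) ∏_{j
∉ X} z_j`, while `sum_det_mul_fermTerm` gives `∑_X D_X S(y_X) = 1` with integers `D_X`. Expanding
the determinant here over subsets of columns produces the same `D_X`. -/
lemma truncHom_fermSeries_zero_mul_det (hG : ∀ i j, G i j = G j i)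
    (hpos : ∀ i, 0 < (c (Finsupp.single i 1)).degree)
    (hF : ∀ i, i ∉ F → M < (c (Finsupp.single i 1)).degree)
    (hz : ∀ i ∈ F, (1 - z i : TruncRing σ M) =
      truncHom σ M (MvPowerSeries.monomial (c (Finsupp.single i 1)) 1) *
        (zMonomial F z (G i) : (TruncRing σ M)ˣ)) :
    truncHom σ M (fermSeries c G 0) * ((∏ j ∈ F, z j : (TruncRing σ M)ˣ) : TruncRing σ M) *
      (Matrix.of fun i j : F => (if i = j then 1 else 0) +
        (G i j : TruncRing σ M) * (((z j)⁻¹ : (TruncRing σ M)ˣ) - 1)).det = 1 := by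
  set y : Finset F → I → ℤ :=
    fun X p => if p ∈ X.map (Function.Embedding.subtype _) then 0 else -1 with hy
  set D : Finset F → ℤ := fun X => (Matrix.of fun i j : F => if j ∈ X then G i j else
        (if i = j then 1 else 0) - G i j).det with hD
  have h1 : (Matrix.of fun i j : F => (if i = j then 1 else 0) +
        (G i j : TruncRing σ M) * (((z j)⁻¹ : (TruncRing σ M)ˣ) - 1)).det =
      ∑ X : Finset F, (D X : TruncRing σ M) * ∏ j : F, if j ∈ X then
        (((z j)⁻¹ : (TruncRing σ M)ˣ) : TruncRing σ M) else 1 := by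
    have h2 := det_columns_combination
      (Matrix.of fun i j : F => (((if i = j then 1 else 0) - G i j : ℤ) : TruncRing σ M))
      (Matrix.of fun i j : F => (G i j : TruncRing σ M))
      (fun j => 1) (fun j => (((z j)⁻¹ : (TruncRing σ M)ˣ) : TruncRing σ M))
    refine Eq.trans ?_ (h2.trans ?_)
    · congr 1
      ext i j
      simp only [Matrix.of_apply]
      split_ifs <;> push_cast <;> ring
    · refine Finset.sum_congr rfl fun X _ => ?_
      congr 1
      rw [hD, Int.cast_det]
      congr 1
      ext i j
      simp only [Matrix.map_apply, Matrix.of_apply]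
      split_ifs <;> rfl
  have h2 : ∀ X : Finset F, truncHom σ M (fermSeries c G 0) *
      ((∏ j ∈ F, z j : (TruncRing σ M)ˣ) : TruncRing σ M) * (∏ j : F, if j ∈ X then
        (((z j)⁻¹ : (TruncRing σ M)ˣ) : TruncRing σ M) else 1) =
      truncHom σ M (fermSeries c G (y X)) := by
    intro X
    have h := twistedSeries_eq hc hG hpos hF hz 0 (y X)
    have h0 : zMonomial F z 0 = 1 := by simp [zMonomial]
    rw [twistedSeries, h0, Units.val_one, mul_one, twistedSeries] at h
    have h3 : zMonomial F z (y X) * (∏ j ∈ F, z j) *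
        (∏ j : F, if j ∈ X then (z j)⁻¹ else 1) = 1 := by
      rw [zMonomial, ← Finset.prod_coe_sort, ← Finset.prod_coe_sort F, ← Finset.prod_mul_distrib,
        ← Finset.prod_mul_distrib]
      refine Finset.prod_eq_one fun j _ => ?_
      have : ((j : I) ∈ X.map (Function.Embedding.subtype (· ∈ F))) ↔ j ∈ X := by simp
      by_cases hj : j ∈ X
      · simp only [hy, if_pos (this.2 hj), if_pos hj]
        simp
      · simp only [hy, if_neg (mt this.1 hj), if_neg hj]
        simp
    have h4 := congrArg Units.val h3
    rw [Units.val_mul, Units.val_mul, Units.val_one] at h4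
    have h5 : (((∏ j : F, if j ∈ X then (z j)⁻¹ else 1 : (TruncRing σ M)ˣ)) : TruncRing σ M) =
        ∏ j : F, if j ∈ X then (((z j)⁻¹ : (TruncRing σ M)ˣ) : TruncRing σ M) else 1 := by
      rw [Units.coe_prod]
      refine Finset.prod_congr rfl fun j _ => ?_
      split_ifs <;> rfl
    rw [h, ← h5, mul_assoc, mul_assoc, ← mul_assoc (Units.val _), h4, mul_one]
  rw [h1, Finset.mul_sum]
  have h3 : ∀ X : Finset F, truncHom σ M (fermSeries c G 0) *
      ((∏ j ∈ F, z j : (TruncRing σ M)ˣ) : TruncRing σ M) * ((D X : TruncRing σ M) *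
        ∏ j : F, if j ∈ X then (((z j)⁻¹ : (TruncRing σ M)ˣ) : TruncRing σ M) else 1) =
      truncHom σ M (MvPowerSeries.C (D X : ℂ) * fermSeries c G (y X)) := by
    intro X
    rw [map_mul, ← h2, map_intCast, map_intCast]
    ring
  rw [Finset.sum_congr rfl fun X _ => h3 X, ← map_sum, ← map_one (truncHom σ M), truncHom_eq_iff]
  intro d hd
  rw [map_sum]
  simp_rw [MvPowerSeries.coeff_C_mul, coeff_fermSeries c hc, Finset.mul_sum]
  rw [Finset.sum_comm]
  have h4 : ∀ N ∈ (hc d).toFinset, ∑ X : Finset F, (D X : ℂ) * (fermTerm G (y X) N : ℂ) =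
      if N = 0 then 1 else 0 := by
    intro N hN
    simp only [Set.Finite.mem_toFinset, Set.mem_ofPred_eq] at hN
    have h := sum_det_mul_fermTerm hG (support_subset_of_degree_le c hF (by rwa [hN]))
    have h' := congrArg (fun r : ℚ => (r : ℂ)) h
    simp only [Rat.cast_sum, Rat.cast_mul, Rat.cast_intCast] at h'
    rw [h']
    split_ifs <;> simp
  rw [Finset.sum_congr rfl h4, Finset.sum_ite_eq']
  classical
  rw [MvPowerSeries.coeff_one]
  simp only [Set.Finite.mem_toFinset, Set.mem_ofPred_eq, map_zero]
  congr 1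
  exact propext eq_comm

end Inversion

/-! ### Inverting second differences. -/

section Sequences

variable {A : Type*} [CommGroup A]

lemma prod_zpow_eq_zpow_sum {I : Type*} (s : Finset I) (f : I → ℤ) (a : A) :
    ∏ i ∈ s, a ^ f i = a ^ ∑ i ∈ s, f i :=
  (map_sum (zmultiplesHom (Additive A) (Additive.ofMul a)) f s).symm

/-- The ratio of consecutive terms is constant, and equals `1` because the sequence is eventually
constant. -/
lemma eq_one_of_second_difference {t : ℕ → A} (h0 : t 0 = 1)
    (h : ∀ m, t (m + 2) * t m = t (m + 1) ^ 2) (hev : ∀ᶠ m in Filter.atTop, t (m + 1) = t m)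
    (m : ℕ) : t m = 1 := by
  have h1 : ∀ m, t (m + 2) / t (m + 1) = t (m + 1) / t m := by
    intro m
    rw [div_eq_div_iff_mul_eq_mul, h, sq]
  have h2 : ∀ m, t (m + 1) / t m = t 1 / t 0 := by
    intro m
    induction m with
    | zero => rfl
    | succ m ih => rw [h1, ih]
  obtain ⟨k, hk⟩ := hev.exists
  have h3 : ∀ m, t (m + 1) = t m := by
    intro m
    have h4 := (h2 m).trans (h2 k).symm
    rwa [hk, div_self', div_eq_one] at h4
  induction m with
  | zero => exact h0
  | succ m ih => rw [h3, ih]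

/-- The right side has the same second differences, the same value at `0`, and is also eventually
constant, so `eq_one_of_second_difference` applies to the quotient. -/
lemma eq_prod_second_difference_zpow {q z : ℕ → A} {M : ℕ} (h0 : q 0 = 1)
    (hz : ∀ m, q (m + 2) * q m = q (m + 1) ^ 2 * z (m + 1)) (hM : ∀ m, M ≤ m → z (m + 1) = 1)
    (hev : ∀ᶠ m in Filter.atTop, q (m + 1) = q m) (m : ℕ) :
    q m = ∏ k ∈ Finset.range M, z (k + 1) ^ (-(min m (k + 1) : ℕ) : ℤ) := by
  set p : ℕ → A := fun m => ∏ k ∈ Finset.range M, z (k + 1) ^ (-(min m (k + 1) : ℕ) : ℤ) with hp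
  have hp2 : ∀ m, p (m + 2) * p m = p (m + 1) ^ 2 * z (m + 1) := by
    intro m
    have h1 : p (m + 2) * p m = p (m + 1) ^ 2 *
        ∏ k ∈ Finset.range M, if k = m then z (m + 1) else 1 := by
      simp only [hp]
      rw [← Finset.prod_pow, ← Finset.prod_mul_distrib, ← Finset.prod_mul_distrib]
      refine Finset.prod_congr rfl fun k _ => ?_
      rw [← zpow_natCast, ← zpow_mul, ← zpow_add]
      split_ifs with hk
      · subst hk
        rw [← zpow_add_one]
        congr 1
        push_cast
        omega
      · rw [mul_one]
        congr 1
        push_cast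
        omega
    rw [h1, Finset.prod_ite_eq']
    split_ifs with hm
    · rfl
    · rw [hM m (by simpa using hm)]
  have ht := eq_one_of_second_difference (t := fun m => q m / p m) ?_ ?_ ?_ m
  · exact div_eq_one.1 ht
  · simp only [hp, h0, one_div, inv_eq_one]
    exact Finset.prod_eq_one fun k _ => by rw [Nat.zero_min, Nat.cast_zero, neg_zero, zpow_zero]
  · intro m
    rw [div_mul_div_comm, hz, hp2, mul_div_mul_right_eq_div, div_pow]
  · filter_upwards [hev, Filter.eventually_ge_atTop M] with m hm hmM
    rw [hm]
    congr 1
    refine Finset.prod_congr rfl fun k hk => ?_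
    have := Finset.mem_range.1 hk
    rw [min_eq_right (by omega), min_eq_right (by omega)]

/-- `min` is the Green function of the negative second difference, with boundary conditions `f 0 =
0` and `f (L + 1) = f L`. -/
lemma sum_second_difference_mul_min {f : ℕ → ℚ} (h0 : f 0 = 0) {L l : ℕ} (hl : l < L)
    (hL : f (L + 1) = f L) :
    ∑ k ∈ Finset.range L, (2 * f (k + 1) - f (k + 2) - f k) * (min (k + 1) (l + 1) : ℕ) =
      f (l + 1) := by
  have h1 : ∀ L, L ≤ l + 1 →
      ∑ k ∈ Finset.range L, (2 * f (k + 1) - f (k + 2) - f k) * (min (k + 1) (l + 1) : ℕ) =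
      (L + 1) * f L - L * f (L + 1) := by
    intro L
    induction L with
    | zero => simp [h0]
    | succ L ih =>
      intro h
      rw [Finset.sum_range_succ, ih (by omega), min_eq_left (by omega)]
      push_cast
      ring
  have h2 : ∀ n, ∑ k ∈ Finset.range (l + 1 + n),
        (2 * f (k + 1) - f (k + 2) - f k) * (min (k + 1) (l + 1) : ℕ) =
      f (l + 1) + (l + 1) * (f (l + 1 + n) - f (l + 1 + n + 1)) := by
    intro n
    induction n with
    | zero =>
      rw [add_zero, h1 _ le_rfl]
      push_cast
      ring
    | succ n ih =>
      rw [← add_assoc, Finset.sum_range_succ, ih, min_eq_right (by omega)]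
      push_cast
      ring_nf
  obtain ⟨n, rfl⟩ := Nat.exists_eq_add_of_lt hl
  have := h2 n
  rw [show l + 1 + n = l + n + 1 by ring, hL] at this
  rw [this]
  ring

end Sequences

/-! ### The quadratic form of the vacancies and its relation to the exponents of the Q-system. -/

section Kernel

variable {ι K V W : Type*} [Fintype ι] [Field K] [CharZero K] [AddCommGroup V] [Module K V]
  [AddCommGroup W] [Module K W] {P : RootPairing ι K V W} [P.IsCrystallographic] (b : P.Base)

/-- The integer `(α_a | α_b) min (t_b m, t_a k)`. -/
def gramMin (p q : H b) : ℤ := ⌊rootInner P p.1 q.1 * minT P p.1 p.2 q.1 q.2⌋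

variable {b}

/-- Whichever of `t_b m` and `t_a k` is the minimum, its product with `(α_a|α_b)` is an integer
multiple of a Cartan integer. -/
lemma cast_gramMin (p q : H b) :
    (gramMin b p q : ℚ) = rootInner P p.1 q.1 * minT P p.1 p.2 q.1 q.2 := by
  suffices h : ∃ n : ℤ, rootInner P p.1 q.1 * minT P p.1 p.2 q.1 q.2 = n by
    obtain ⟨n, hn⟩ := h
    rw [gramMin, hn, Int.floor_intCast]
  rw [minT]
  rcases min_choice (tval P q.1 * ((p.2 : ℕ) : ℚ)) (tval P p.1 * ((q.2 : ℕ) : ℚ)) with h | h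
  · refine ⟨P.pairingIn ℤ p.1 q.1 * (p.2 : ℕ), ?_⟩
    rw [h, ← mul_assoc, rootInner_mul_tval]
    push_cast
    rfl
  · refine ⟨P.pairingIn ℤ q.1 p.1 * (q.2 : ℕ), ?_⟩
    rw [h, ← mul_assoc, rootInner_comm, rootInner_mul_tval]
    push_cast
    rfl

lemma gramMin_comm (p q : H b) : gramMin b p q = gramMin b q p := by
  rw [gramMin, gramMin, rootInner_comm, minT, minT, min_comm]

open Classical in
/-- The integer `min (m, k)` if the colours of the two indices agree, and zero otherwise. -/
def colourMin (q p : H b) : ℤ := if q.1 = p.1 then (min (q.2 : ℕ) (p.2 : ℕ) : ℕ) else 0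

/-- The integer `∑_k min (m, k) ν_k^{(a)}`. -/
def gammaInt (ν : H b →₀ ℕ) (p : H b) : ℤ := ν.sum fun q n => colourMin q p * n

lemma cast_gammaInt (ν : H b →₀ ℕ) (p : H b) : (gammaInt ν p : ℚ) = gamma ν p := by
  classical
  rw [gammaInt, gamma, Finsupp.sum, Finsupp.sum, Int.cast_sum]
  refine Finset.sum_congr rfl fun q _ => ?_
  rw [colourMin]
  split_ifs with h
  · push_cast
    rw [min_comm]
  · simp

variable (b) in
/-- The map `content` as a homomorphism. -/
def contentHom : (H b →₀ ℕ) →+ (b.support →₀ ℕ) where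
  toFun := content
  map_zero' := by simp [content]
  map_add' N N' := by
    classical
    rw [content, Finsupp.sum_add_index' (by simp)]
    · rfl
    · intro p m n
      rw [mul_add, Finsupp.single_add]

lemma contentHom_single (p : H b) :
    contentHom b (Finsupp.single p 1) = Finsupp.single p.1 (p.2 : ℕ) := by
  change content _ = _
  rw [content, Finsupp.sum_single_index (by simp), mul_one]

lemma degree_contentHom_single (p : H b) :
    (contentHom b (Finsupp.single p 1)).degree = (p.2 : ℕ) := by
  rw [contentHom_single, Finsupp.degree_single]

lemma finite_contentHom (d : b.support →₀ ℕ) : {N | contentHom b N = d}.Finite :=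
  finite_content d

lemma Knum_eq_fermTerm (ν N : H b →₀ ℕ) : Knum ν N = fermTerm (gramMin b) (gammaInt ν) N := by
  refine Finset.prod_congr rfl fun p _ => ?_
  congr 2
  rw [vacancy, Int.cast_sub, cast_gammaInt, pairSum, Finsupp.sum, Finsupp.sum, Int.cast_sum]
  congr 1
  refine Finset.sum_congr rfl fun q _ => ?_
  rw [Int.cast_mul, cast_gramMin, Int.cast_natCast]

lemma Ktilde_eq_fermSeries (ν : H b →₀ ℕ) :
    Ktilde ν = fermSeries (contentHom b) (gramMin b) (gammaInt ν) := by
  funext d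
  simp only [Ktilde, fermSeries, Knum_eq_fermTerm]
  rfl

lemma gammaInt_zero : gammaInt (0 : H b →₀ ℕ) = 0 := by
  funext p
  simp [gammaInt]

variable (b) in
/-- The set of the indices `(a, m)` with `m ≤ M`. -/
def truncIndex (M : ℕ) : Finset (H b) :=
  Finset.univ ×ˢ (Finset.range M).map ⟨Nat.succPNat, Nat.succPNat_injective⟩

lemma mem_truncIndex {M : ℕ} {p : H b} : p ∈ truncIndex b M ↔ (p.2 : ℕ) ≤ M := by
  simp only [truncIndex, Finset.mem_product, Finset.mem_univ, true_and, Finset.mem_map,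
    Finset.mem_range, Function.Embedding.coeFn_mk]
  constructor
  · rintro ⟨k, hk, hk'⟩
    rw [← hk', Nat.succPNat_coe]
    omega
  · intro h
    exact ⟨p.2.natPred, by have := p.2.natPred_add_one; omega, p.2.succPNat_natPred⟩

lemma prod_truncIndex {A : Type*} [CommMonoid A] (M : ℕ) (f : H b → A) :
    ∏ p ∈ truncIndex b M, f p = ∏ a : b.support, ∏ k ∈ Finset.range M, f (a, Nat.succPNat k) := by
  rw [truncIndex, Finset.prod_product]
  refine Finset.prod_congr rfl fun a _ => ?_
  rw [Finset.prod_map]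
  rfl

lemma sum_truncIndex {A : Type*} [AddCommMonoid A] (M : ℕ) (f : H b → A) :
    ∑ p ∈ truncIndex b M, f p = ∑ a : b.support, ∑ k ∈ Finset.range M, f (a, Nat.succPNat k) := by
  rw [truncIndex, Finset.sum_product]
  refine Finset.sum_congr rfl fun a _ => ?_
  rw [Finset.sum_map]
  rfl

variable [P.IsReduced] [P.IsIrreducible]

lemma exists_minT_eq (i : ι) (m : ℕ) :
    ∃ L : ℕ, ∀ (j : b.support) (k : ℕ), L ≤ k → minT P i m j k = tval P j * m := by
  -- `3` bounds `t_j / t_i`, as both lie in `{1, 2, 3}`.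
  refine ⟨3 * m, fun j k hk => min_eq_left ?_⟩
  have hk' : (3 : ℚ) * m ≤ k := by exact_mod_cast hk
  have hm : (0 : ℚ) ≤ m := by positivity
  rcases tval_mem P i with h | h | h <;> rcases tval_mem P (j : ι) with h' | h' | h' <;>
    rw [h, h'] <;> linarith

lemma expo_eq_zero {i : ι} {m : ℕ} {L : ℕ} {j : ι}
    (hL : ∀ k : ℕ, L ≤ k → minT P i m j k = tval P j * m) {k : ℕ+} (hk : L < k) :
    expo P i m j k = 0 := by
  rw [expo, Bfun, hL _ hk.le, hL _ (by omega), hL _ (by omega)]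
  ring_nf
  simp

/-- The exponents of the Q-system are second differences of `gramMin`; summing them against `min`
undoes the differences. This turns the exponents of `Q̃` into exponents of `z`. -/
lemma sum_expo_mul_colourMin (p q : H b) {L : ℕ} (hq : (q.2 : ℕ) ≤ L)
    (hL : ∀ (j : b.support) (k : ℕ), L ≤ k → minT P p.1 p.2 j k = tval P j * (p.2 : ℕ)) :
    ∑ r ∈ truncIndex b L, expo P p.1 p.2 r.1 r.2 * colourMin r q = gramMin b p q := by
  classical
  rw [sum_truncIndex, Finset.sum_eq_single q.1]
  · have h := sum_second_difference_mul_min (f := fun k => minT P p.1 p.2 q.1 k) (L := L)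
      (l := q.2.natPred) ?_ ?_ ?_
    · rw [← Int.cast_inj (α := ℚ), Int.cast_sum, cast_gramMin]
      rw [q.2.natPred_add_one] at h
      rw [← h, Finset.mul_sum]
      refine Finset.sum_congr rfl fun k _ => ?_
      rw [Int.cast_mul, cast_expo, colourMin, if_pos rfl, Bfun, Int.cast_natCast,
        Nat.succPNat_coe, Nat.succ_eq_add_one, Nat.add_sub_cancel, mul_assoc]
    · have := tval_pos P q.1
      simp only [minT, Nat.cast_zero, mul_zero]
      exact min_eq_right (by positivity)
    · have := q.2.natPred_add_one
      omega
    · rw [hL _ _ (by omega), hL _ _ le_rfl]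
  · intro a _ ha
    refine Finset.sum_eq_zero fun k _ => ?_
    rw [colourMin, if_neg ha, mul_zero]
  · simp

end Kernel

/-! ### The Q-system in the variables `z`, and the formula `K̃^ν = Q̃^ν K̃^0`. -/

section Family

variable {ι K V W : Type*} [Fintype ι] [Field K] [CharZero K] [AddCommGroup V] [Module K V]
  [AddCommGroup W] [Module K W] {P : RootPairing ι K V W} [P.IsCrystallographic] {b : P.Base}
  (Q : b.support → ℕ → (MvPowerSeries b.support ℂ)ˣ) (M : ℕ)

/-- The truncation of the unit `Q̃_m^{(a)}`. -/
def qTrunc (a : b.support) (m : ℕ) : (TruncRing b.support M)ˣ :=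
  Units.map (truncHom b.support M).toMonoidHom (Q a m)

lemma coe_qTrunc (a : b.support) (m : ℕ) :
    (qTrunc Q M a m : TruncRing b.support M) = truncHom b.support M (Q a m) := rfl

/-- The unit `Q̃_{m+1}^{(a)} Q̃_{m-1}^{(a)} (Q̃_m^{(a)})⁻²` of the truncated ring. -/
def zTrunc (p : H b) : (TruncRing b.support M)ˣ :=
  qTrunc Q M p.1 (p.2 + 1) * qTrunc Q M p.1 (p.2 - 1) / qTrunc Q M p.1 p.2 ^ 2

variable {Q} (hQ : IsQFamily b Q)

include hQ

/-- The Q-system divided by the square of `Q̃_m^{(a)}`. -/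
lemma one_sub_zTrunc (p : H b) :
    (1 - zTrunc Q M p : TruncRing b.support M) =
      truncHom b.support M (MvPowerSeries.monomial (contentHom b (Finsupp.single p 1)) 1) *
        (Units.map (truncHom b.support M).toMonoidHom
          (∏ᶠ r : H b, Q r.1 r.2 ^ (-expo P p.1 p.2 r.1 r.2)) : (TruncRing b.support M)ˣ) := by
  have h := congrArg (truncHom b.support M) (hQ.qsystem p.1 p.2 p.2.pos)
  have hX : (MvPowerSeries.monomial (contentHom b (Finsupp.single p 1)) 1 :
      MvPowerSeries b.support ℂ) = MvPowerSeries.X p.1 ^ (p.2 : ℕ) := by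
    rw [contentHom_single, MvPowerSeries.X_pow_eq]
  have hz : (zTrunc Q M p : TruncRing b.support M) * truncHom b.support M (Q p.1 p.2) ^ 2 =
      truncHom b.support M (Q p.1 (p.2 + 1)) * truncHom b.support M (Q p.1 (p.2 - 1)) := by
    have : zTrunc Q M p * qTrunc Q M p.1 p.2 ^ 2 =
        qTrunc Q M p.1 (p.2 + 1) * qTrunc Q M p.1 (p.2 - 1) := by
      rw [zTrunc, div_mul_cancel]
    exact congrArg Units.val this
  have hu : IsUnit (truncHom b.support M (Q p.1 p.2) ^ 2) :=
    (qTrunc Q M p.1 p.2 ^ 2).isUnit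
  apply hu.mul_right_cancel
  rw [hX]
  change _ = _ * truncHom b.support M _ * _
  simp only [map_pow, map_mul, map_add] at h ⊢
  linear_combination h - hz

lemma zTrunc_eq_one {p : H b} (hp : M < p.2) : zTrunc Q M p = 1 := by
  have h := one_sub_zTrunc M hQ p
  rw [truncHom_monomial_eq_zero (by rwa [degree_contentHom_single]), zero_mul, sub_eq_zero] at h
  exact Units.ext h.symm

lemma eventually_qTrunc (a : b.support) :
    ∀ᶠ m in Filter.atTop, qTrunc Q M a (m + 1) = qTrunc Q M a m := by
  classical
  obtain ⟨L, hL⟩ := hQ.convergent a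
  have hfin : {d : b.support →₀ ℕ | d.degree ≤ M}.Finite := by
    refine Set.Finite.subset (Set.finite_Iic (Finsupp.equivFunOnFinite.symm fun _ => M)) ?_
    intro d hd i
    exact (Finsupp.le_degree i d).trans hd
  have h := (Filter.eventually_all_finite hfin).2 fun d _ => hL d
  have h' : ∀ᶠ m in Filter.atTop, truncHom b.support M (Q a m) = truncHom b.support M L := by
    filter_upwards [h] with m hm
    exact truncHom_eq_iff.2 hm
  filter_upwards [h', (Filter.tendsto_add_atTop_nat 1).eventually h'] with m h1 h2
  exact Units.ext (h2.trans h1.symm)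

/-- In the truncated ring the limit makes `m ↦ qTrunc Q M a m` eventually constant, and `z_m = 1`
for `m > M`; so the second differences can be inverted by a finite product. -/
lemma qTrunc_eq_zMonomial (p : H b) :
    qTrunc Q M p.1 p.2 = zMonomial (truncIndex b M) (zTrunc Q M) (fun j => -colourMin p j) := by
  classical
  have h := eq_prod_second_difference_zpow (q := qTrunc Q M p.1)
    -- The value at `m = 0` is arbitrary: only `z (m + 1)` occurs.
    (z := fun m => if h : 0 < m then zTrunc Q M (p.1, ⟨m, h⟩) else 1) (M := M) ?_ ?_ ?_ ?_ p.2
  · rw [h, zMonomial, prod_truncIndex, Finset.prod_eq_single p.1]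
    · refine Finset.prod_congr rfl fun k _ => ?_
      rw [dif_pos (Nat.succ_pos k), colourMin, if_pos rfl]
      rfl
    · intro a _ ha
      refine Finset.prod_eq_one fun k _ => ?_
      rw [colourMin, if_neg (Ne.symm ha), neg_zero, zpow_zero]
    · simp
  · rw [qTrunc, hQ.zero, map_one]
  · intro m
    rw [dif_pos (Nat.succ_pos m)]
    change _ = qTrunc Q M p.1 (m + 1) ^ 2 * (qTrunc Q M p.1 (m + 2) * qTrunc Q M p.1 m /
      qTrunc Q M p.1 (m + 1) ^ 2)
    exact (mul_div_cancel (qTrunc Q M p.1 (m + 1) ^ 2) _).symm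
  · intro m hm
    rw [dif_pos (Nat.succ_pos m)]
    exact zTrunc_eq_one M hQ (Nat.lt_succ_of_le hm)
  · exact eventually_qTrunc M hQ p.1

lemma truncHom_Qtilde (ν : H b →₀ ℕ) :
    truncHom b.support M (Qtilde Q ν) =
      (zMonomial (truncIndex b M) (zTrunc Q M) (fun j => -gammaInt ν j) :
        (TruncRing b.support M)ˣ) := by
  have h : zMonomial (truncIndex b M) (zTrunc Q M) (fun j => -gammaInt ν j) =
      ∏ p ∈ ν.support, qTrunc Q M p.1 p.2 ^ ν p := by
    simp_rw [qTrunc_eq_zMonomial M hQ, zMonomial, ← Finset.prod_pow]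
    rw [Finset.prod_comm]
    refine Finset.prod_congr rfl fun j _ => ?_
    simp_rw [← zpow_natCast, ← zpow_mul]
    refine Eq.trans ?_ (prod_zpow_eq_zpow_sum _ _ _).symm
    rw [gammaInt, Finsupp.sum, ← Finset.sum_neg_distrib]
    congr 1
    exact Finset.sum_congr rfl fun q _ => by ring
  rw [h, Units.coe_prod, Qtilde, Finsupp.prod, map_prod]
  refine Finset.prod_congr rfl fun p _ => ?_
  rw [map_pow, Units.val_pow_eq_pow_val, coe_qTrunc]

variable [P.IsReduced] [P.IsIrreducible]

/-- Each `Q̃` on the right of the Q-system is replaced by its product of powers of the `z_j`; the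
total exponent of `z_j` is then computed by `sum_expo_mul_colourMin`. The result is the hypothesis
`hz` of the inversion lemmas. -/
lemma one_sub_zTrunc_eq (p : H b) :
    (1 - zTrunc Q M p : TruncRing b.support M) =
      truncHom b.support M (MvPowerSeries.monomial (contentHom b (Finsupp.single p 1)) 1) *
        (zMonomial (truncIndex b M) (zTrunc Q M) (gramMin b p) : (TruncRing b.support M)ˣ) := by
  rw [one_sub_zTrunc M hQ]
  congr 2
  obtain ⟨L, hL⟩ := exists_minT_eq (b := b) (p.1 : ι) (p.2 : ℕ)
  have hL' : ∀ (j : b.support) (k : ℕ), max L M ≤ k →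
      minT P p.1 p.2 j k = tval P j * (p.2 : ℕ) := fun j k hk => hL j k ((le_max_left _ _).trans hk)
  rw [finprod_eq_prod_of_mulSupport_subset (s := truncIndex b (max L M)), map_prod]
  · have h1 : ∀ r : H b, Units.map (truncHom b.support M).toMonoidHom
        (Q r.1 r.2 ^ (-expo P p.1 p.2 r.1 r.2)) =
        ∏ j ∈ truncIndex b M, zTrunc Q M j ^ (expo P p.1 p.2 r.1 r.2 * colourMin r j) := by
      intro r
      rw [map_zpow]
      change qTrunc Q M r.1 r.2 ^ _ = _
      rw [qTrunc_eq_zMonomial M hQ, zMonomial]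
      refine (Finset.prod_zpow (fun j => zTrunc Q M j ^ (-colourMin r j)) (truncIndex b M)
        (-expo P p.1 p.2 r.1 r.2)).symm.trans ?_
      refine Finset.prod_congr rfl fun j _ => ?_
      rw [← zpow_mul]
      congr 1
      ring
    rw [Finset.prod_congr rfl fun r _ => h1 r, Finset.prod_comm, zMonomial]
    refine Finset.prod_congr rfl fun j hj => ?_
    refine (prod_zpow_eq_zpow_sum _ _ _).trans ?_
    rw [sum_expo_mul_colourMin p j ((mem_truncIndex.1 hj).trans (le_max_right _ _)) hL']
  · intro r hr
    by_contra h
    have h2 : max L M < r.2 := by simpa [mem_truncIndex] using h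
    apply hr
    change Q r.1 r.2 ^ _ = 1
    rw [expo_eq_zero (hL' r.1) h2, neg_zero, zpow_zero]

omit hQ in
lemma lt_degree_of_notMem_truncIndex (p : H b) (hp : p ∉ truncIndex b M) :
    M < (contentHom b (Finsupp.single p 1)).degree := by
  rw [degree_contentHom_single]
  rw [mem_truncIndex] at hp
  omega

omit hQ in
lemma degree_contentHom_single_pos (p : H b) :
    0 < (contentHom b (Finsupp.single p 1)).degree := by
  rw [degree_contentHom_single]
  exact p.2.pos

/-- The power series formula for the solutions of the Q-system. -/
theorem Ktilde_eq_Qtilde_mul (ν : H b →₀ ℕ) : Ktilde ν = Qtilde Q ν * Ktilde (0 : H b →₀ ℕ) := by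
  classical
  refine eq_of_truncHom_eq fun M => ?_
  -- The shifts `γ(ν)` and `0` give `K̃^ν z^{γ(ν)} = K̃^0`, and `z^{-γ(ν)}` is `Q̃^ν` by
  -- `truncHom_Qtilde`.
  have h := twistedSeries_eq finite_contentHom gramMin_comm degree_contentHom_single_pos
    (lt_degree_of_notMem_truncIndex M) (fun i _ => one_sub_zTrunc_eq M hQ i) (gammaInt ν)
    (gammaInt 0)
  simp only [twistedSeries, ← Ktilde_eq_fermSeries] at h
  have h0 : zMonomial (truncIndex b M) (zTrunc Q M) (gammaInt 0) = 1 := by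
    simp [gammaInt_zero, zMonomial]
  have h1 : zMonomial (truncIndex b M) (zTrunc Q M) (gammaInt ν) *
      zMonomial (truncIndex b M) (zTrunc Q M) (fun j => -gammaInt ν j) = 1 := by
    rw [← zMonomial_add, ← h0]
    congr 1
    funext j
    simp [gammaInt_zero]
  have h1' := congrArg Units.val h1
  rw [Units.val_mul, Units.val_one] at h1'
  rw [h0, Units.val_one, mul_one] at h
  rw [map_mul, truncHom_Qtilde M hQ, ← h, mul_comm, mul_assoc, h1', mul_one]

/-- The determinant formula for the normalizing factor. -/
theorem truncHom_Ktilde_zero_mul_det [DecidableEq (truncIndex b M)] :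
    truncHom b.support M (Ktilde (0 : H b →₀ ℕ)) *
      ((∏ j ∈ truncIndex b M, zTrunc Q M j : (TruncRing b.support M)ˣ) : TruncRing b.support M) *
      (1 + Matrix.of fun i j : truncIndex b M => (gramMin b i j : TruncRing b.support M) *
        (((zTrunc Q M j)⁻¹ : (TruncRing b.support M)ˣ) - 1)).det = 1 := by
  classical
  have h := truncHom_fermSeries_zero_mul_det finite_contentHom gramMin_comm
    degree_contentHom_single_pos (lt_degree_of_notMem_truncIndex M)
    (fun i _ => one_sub_zTrunc_eq M hQ i)
  rw [Ktilde_eq_fermSeries, gammaInt_zero]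
  convert h using 3
  ext i j
  rw [Matrix.add_apply, Matrix.one_apply, Matrix.of_apply, Matrix.of_apply]
  congr

end Family

/-! ### Logarithmic derivatives of units. -/

section LogarithmicDerivative

variable {R : Type*} [CommRing R] (D : Derivation ℤ R R)

/-- The logarithmic derivative on the units of a ring. -/
def logDer : Additive Rˣ →+ R where
  toFun u := ((u.toMul⁻¹ : Rˣ) : R) * D (u.toMul : Rˣ)
  map_zero' := by simp
  map_add' u v := by
    rw [toMul_add, mul_inv, Units.val_mul, Units.val_mul, D.leibniz, smul_eq_mul, smul_eq_mul]
    have hu := Units.inv_mul u.toMul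
    have hv := Units.inv_mul v.toMul
    linear_combination (((v.toMul⁻¹ : Rˣ) : R) * D (v.toMul : Rˣ)) * hu +
      (((u.toMul⁻¹ : Rˣ) : R) * D (u.toMul : Rˣ)) * hv

lemma mul_logDer (u : Rˣ) : (u : R) * logDer D (Additive.ofMul u) = D u := by
  change (u : R) * (((u⁻¹ : Rˣ) : R) * D u) = D u
  rw [← mul_assoc, Units.mul_inv, one_mul]

lemma logDer_prod_zpow {I : Type*} (s : Finset I) (z : I → Rˣ) (x : I → ℤ) :
    logDer D (Additive.ofMul (∏ j ∈ s, z j ^ x j)) =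
      ∑ j ∈ s, (x j : R) * logDer D (Additive.ofMul (z j)) := by
  rw [ofMul_prod, map_sum]
  refine Finset.sum_congr rfl fun j _ => ?_
  rw [ofMul_zpow, map_zsmul, zsmul_eq_mul]

end LogarithmicDerivative

/-! ### The derivations `y_c ∂/∂y_c`, also on truncated series. -/

section Euler

variable {σ : Type*}

/-- The derivation `y_c ∂/∂y_c`. -/
def eulerDer (c : σ) : Derivation ℂ (MvPowerSeries σ ℂ) (MvPowerSeries σ ℂ) :=
  (MvPowerSeries.X c : MvPowerSeries σ ℂ) • MvPowerSeries.pderiv ℂ c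

lemma coeff_eulerDer (c : σ) (f : MvPowerSeries σ ℂ) (d : σ →₀ ℕ) :
    MvPowerSeries.coeff d (eulerDer c f) = d c * MvPowerSeries.coeff d f := by
  classical
  change MvPowerSeries.coeff d (MvPowerSeries.X c * MvPowerSeries.pderiv ℂ c f) = _
  rw [MvPowerSeries.X, MvPowerSeries.coeff_monomial_mul]
  split_ifs with h
  · rw [one_mul, MvPowerSeries.coeff_pderiv, tsub_add_cancel_of_le h, mul_comm]
    congr 1
    have h1 : 1 ≤ d c := Finsupp.single_le_iff.1 h
    rw [Finsupp.tsub_apply, Finsupp.single_eq_same, Nat.cast_sub h1]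
    simp
  · have h0 : d c = 0 := by
      by_contra h1
      exact h (Finsupp.single_le_iff.2 (Nat.one_le_iff_ne_zero.2 h1))
    rw [h0, Nat.cast_zero, zero_mul]

lemma eulerDer_monomial (c : σ) (d : σ →₀ ℕ) (r : ℂ) :
    eulerDer c (MvPowerSeries.monomial d r) = (d c : MvPowerSeries σ ℂ) *
      MvPowerSeries.monomial d r := by
  classical
  ext e
  rw [coeff_eulerDer, ← map_natCast (MvPowerSeries.C (σ := σ) (R := ℂ)),
    MvPowerSeries.coeff_C_mul, MvPowerSeries.coeff_monomial]
  split_ifs with h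
  · rw [h]
  · simp

lemma truncHom_eulerDer_congr {M : ℕ} (c : σ) {f g : MvPowerSeries σ ℂ}
    (h : truncHom σ M f = truncHom σ M g) :
    truncHom σ M (eulerDer c f) = truncHom σ M (eulerDer c g) := by
  rw [truncHom_eq_iff] at h ⊢
  intro d hd
  rw [coeff_eulerDer, coeff_eulerDer, h d hd]

/-- The derivation of the truncated ring induced by `y_c ∂/∂y_c`. -/
def truncDer (M : ℕ) (c : σ) : Derivation ℤ (TruncRing σ M) (TruncRing σ M) :=
  -- The choice of lifts does not matter: `y_c ∂/∂y_c` only rescales each coefficient, so it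
  -- respects truncation (`truncHom_eulerDer_congr`).
  let out : TruncRing σ M → MvPowerSeries σ ℂ := Function.surjInv (truncHom_surjective M)
  have hout : ∀ r : TruncRing σ M, truncHom σ M (out r) = r :=
    Function.surjInv_eq (truncHom_surjective M)
  Derivation.mk' (AddMonoidHom.toIntLinearMap
    { toFun := fun r => truncHom σ M (eulerDer c (out r))
      map_zero' := by
        rw [truncHom_eulerDer_congr c ((hout 0).trans (map_zero _).symm), map_zero, map_zero]
      map_add' := fun r s => by
        rw [truncHom_eulerDer_congr c (g := out r + out s), map_add, map_add]
        rw [hout, map_add, hout, hout] })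
    (fun r s => by
      change truncHom σ M (eulerDer c (out (r * s))) =
        r * truncHom σ M (eulerDer c (out s)) +
          s * truncHom σ M (eulerDer c (out r))
      rw [truncHom_eulerDer_congr c (g := out r * out s), Derivation.leibniz,
        map_add, smul_eq_mul, smul_eq_mul, map_mul, map_mul, hout, hout]
      rw [hout, map_mul, hout, hout])

lemma truncDer_truncHom (M : ℕ) (c : σ) (f : MvPowerSeries σ ℂ) :
    truncDer M c (truncHom σ M f) = truncHom σ M (eulerDer c f) :=
  truncHom_eulerDer_congr c (Function.surjInv_eq (truncHom_surjective M) _)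

end Euler

/-! ### A determinant identity of Sylvester type. -/

section JacobianMatrices

variable {R m n : Type*} [CommRing R] [Fintype m] [DecidableEq m] [Fintype n] [DecidableEq n]

/-- The hypothesis says `(1 + u G) x = u L`. By Sylvester's identity the two factors become `det(1 -
x A S)` and `det(1 + u G)`, and `(1 + u G)(1 - x A S) = 1 + u G - u L A S`. -/
lemma det_one_sub_mul_det_one_add (S : Matrix n m R) (x : Matrix m n R) (A : Matrix n n R)
    (u : m → R) (G : Matrix m m R) (L : Matrix m n R)
    (hx : x = Matrix.diagonal u * (L - G * x)) :
    (1 - S * x * A).det * (1 + G * Matrix.diagonal u).det =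
      (1 + Matrix.diagonal u * (G - L * A * S)).det := by
  have h1 : (1 + Matrix.diagonal u * G) * x = Matrix.diagonal u * L := by
    rw [Matrix.add_mul, Matrix.one_mul]
    nth_rw 1 [hx]
    rw [Matrix.mul_sub, Matrix.mul_assoc]
    abel
  rw [Matrix.mul_assoc, Matrix.det_one_sub_mul_comm, Matrix.det_one_add_mul_comm, mul_comm,
    ← Matrix.det_mul, Matrix.mul_sub, Matrix.mul_one, ← Matrix.mul_assoc, ← Matrix.mul_assoc, h1,
    Matrix.mul_sub]
  simp only [Matrix.mul_assoc]
  rw [add_sub_assoc]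

end JacobianMatrices

/-! ### The series `K̃^0` as a Jacobian determinant. -/

section Jacobian

variable {ι K V W : Type*} [Fintype ι] [Field K] [CharZero K] [AddCommGroup V] [Module K V]
  [AddCommGroup W] [Module K W] {P : RootPairing ι K V W} [P.IsCrystallographic] {b : P.Base}
  (Q : b.support → ℕ → (MvPowerSeries b.support ℂ)ˣ) (M : ℕ)

open Classical in
/-- The Jacobian matrix of `Q_1^{(1)}(x), …, Q_1^{(n)}(x)` with respect to the derivations
`x_b ∂/∂x_b`, without the factors `x_a`. -/
def jacobianMatrix : Matrix b.support b.support (MvPowerSeries b.support ℂ) :=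
  Matrix.of fun a a' => (if a = a' then (Q a 1 : MvPowerSeries b.support ℂ) else 0) -
    ∑ c : b.support, (P.pairingIn ℤ c a' : MvPowerSeries b.support ℂ) *
      eulerDer c (Q a 1 : MvPowerSeries b.support ℂ)

variable {Q} [P.IsReduced] [P.IsIrreducible] (hQ : IsQFamily b Q)

include hQ

/-- Apply `y_c ∂/∂y_c` to `1 - z_i = y^{c_i} z^{G_i}` and divide by `z_i`, using `(1 - z_i)/z_i =
z_i⁻¹ - 1`. This is the linear system `x = u (L - G x)` of `det_one_sub_mul_det_one_add`. -/
lemma neg_logDer_zTrunc (c : b.support) (i : H b) :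
    -logDer (truncDer M c) (Additive.ofMul (zTrunc Q M i)) =
      ((((zTrunc Q M i)⁻¹ : (TruncRing b.support M)ˣ) : TruncRing b.support M) - 1) *
        ((Finsupp.single i.1 (i.2 : ℕ) c : ℕ) - ∑ j ∈ truncIndex b M, (gramMin b i j :
          TruncRing b.support M) * -logDer (truncDer M c) (Additive.ofMul (zTrunc Q M j))) := by
  have h := one_sub_zTrunc_eq M hQ i
  have hd := congrArg (truncDer M c) h
  rw [map_sub, Derivation.map_one_eq_zero, Derivation.leibniz, truncDer_truncHom,
    contentHom_single, eulerDer_monomial, ← mul_logDer, ← mul_logDer, zMonomial,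
    logDer_prod_zpow, map_mul, map_natCast, smul_eq_mul, smul_eq_mul] at hd
  rw [contentHom_single, zMonomial] at h
  have hz := Units.inv_mul (zTrunc Q M i)
  have hs : ∑ j ∈ truncIndex b M, (gramMin b i j : TruncRing b.support M) *
      -logDer (truncDer M c) (Additive.ofMul (zTrunc Q M j)) =
      -∑ j ∈ truncIndex b M, (gramMin b i j : TruncRing b.support M) *
        logDer (truncDer M c) (Additive.ofMul (zTrunc Q M j)) := by
    rw [← Finset.sum_neg_distrib]
    exact Finset.sum_congr rfl fun j _ => mul_neg _ _
  rw [hs]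
  generalize ∑ j ∈ truncIndex b M, (gramMin b i j : TruncRing b.support M) *
        logDer (truncDer M c) (Additive.ofMul (zTrunc Q M j)) = s at *
  generalize (((Finsupp.single i.1 (i.2 : ℕ) c : ℕ)) : TruncRing b.support M) = m at *
  generalize logDer (truncDer M c) (Additive.ofMul (zTrunc Q M i)) = l at *
  generalize ((zTrunc Q M i : (TruncRing b.support M)ˣ) : TruncRing b.support M) = z at *
  generalize (((zTrunc Q M i)⁻¹ : (TruncRing b.support M)ˣ) : TruncRing b.support M) = z' at *
  linear_combination z' * hd + (l - m - s) * hz - z' * (m + s) * h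

lemma logDer_qTrunc (c a : b.support) :
    logDer (truncDer M c) (Additive.ofMul (qTrunc Q M a 1)) =
      -∑ j ∈ truncIndex b M, (colourMin (a, 1) j : TruncRing b.support M) *
        logDer (truncDer M c) (Additive.ofMul (zTrunc Q M j)) := by
  have h := qTrunc_eq_zMonomial M hQ (a, 1)
  change qTrunc Q M a 1 = _ at h
  rw [h, zMonomial, logDer_prod_zpow, ← Finset.sum_neg_distrib]
  refine Finset.sum_congr rfl fun j _ => ?_
  push_cast
  ring

lemma sum_colourMin_one (j : H b) : ∑ a : b.support, colourMin (a, 1) j = 1 := by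
  classical
  rw [Finset.sum_eq_single j.1]
  · have := j.2.pos
    simp only [colourMin, if_true, PNat.one_coe]
    norm_cast
    omega
  · intro a _ ha
    rw [colourMin, if_neg ha]
  · simp

/-- Every `z_j` occurs in exactly one of the `Q̃_1^{(a)}`, with exponent `-1`, since `min(1, k) =
1`. -/
lemma prod_qTrunc_mul_prod_zTrunc :
    (∏ a : b.support, qTrunc Q M a 1) * ∏ j ∈ truncIndex b M, zTrunc Q M j = 1 := by
  have h : ∏ a : b.support, qTrunc Q M a 1 = ∏ j ∈ truncIndex b M, zTrunc Q M j ^ (-1 : ℤ) := by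
    have h1 : ∀ a : b.support, qTrunc Q M a 1 =
        ∏ j ∈ truncIndex b M, zTrunc Q M j ^ (-colourMin (a, 1) j) :=
      fun a => qTrunc_eq_zMonomial M hQ (a, 1)
    rw [Finset.prod_congr rfl fun a _ => h1 a, Finset.prod_comm]
    refine Finset.prod_congr rfl fun j _ => ?_
    refine (prod_zpow_eq_zpow_sum _ _ _).trans ?_
    rw [Finset.sum_neg_distrib, sum_colourMin_one hQ]
  rw [h, ← Finset.prod_mul_distrib]
  exact Finset.prod_eq_one fun j _ => by simp

/-- The normalizing factor is the Jacobian determinant. -/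
theorem det_jacobianMatrix [DecidableEq b.support] :
    (jacobianMatrix Q).det = Ktilde (0 : H b →₀ ℕ) := by
  classical
  refine eq_of_truncHom_eq fun M => ?_
  set z := zTrunc Q M
  let S : Matrix b.support (truncIndex b M) (TruncRing b.support M) :=
    Matrix.of fun a j => (colourMin (a, 1) (j : H b) : TruncRing b.support M)
  let x : Matrix (truncIndex b M) b.support (TruncRing b.support M) :=
    Matrix.of fun i c => -logDer (truncDer M c) (Additive.ofMul (zTrunc Q M i))
  let A : Matrix b.support b.support (TruncRing b.support M) :=
    Matrix.of fun c a => (P.pairingIn ℤ c a : TruncRing b.support M)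
  let u : truncIndex b M → TruncRing b.support M :=
    fun j => (((zTrunc Q M j)⁻¹ : (TruncRing b.support M)ˣ) : TruncRing b.support M) - 1
  let G : Matrix (truncIndex b M) (truncIndex b M) (TruncRing b.support M) :=
    Matrix.of fun i j => (gramMin b (i : H b) j : TruncRing b.support M)
  let L : Matrix (truncIndex b M) b.support (TruncRing b.support M) :=
    Matrix.of fun i c => ((Finsupp.single (i : H b).1 ((i : H b).2 : ℕ) c : ℕ) :
      TruncRing b.support M)
  have hx : x = Matrix.diagonal u * (L - G * x) := by
    ext i c
    rw [Matrix.diagonal_mul, Matrix.sub_apply, Matrix.mul_apply]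
    refine (neg_logDer_zTrunc M hQ c i).trans ?_
    rw [← Finset.sum_coe_sort (truncIndex b M)]
    rfl
  have hdet := det_one_sub_mul_det_one_add S x A u G L hx
  -- Grade the index `(a, m)` by `m / t_a`. If `m / t_a ≤ k / t_b`, then `min(t_b m, t_a k) = t_b
  -- m`, so the entry of `G` is `m` times the Cartan integer of `(a, b)`, which is the entry of `L A
  -- S`. Hence the difference is strictly triangular.
  have hone : (1 + Matrix.diagonal u * (G - L * A * S)).det = 1 := by
    refine det_one_add_of_strictly_triangular _
      (fun i : truncIndex b M => ((i : H b).2 : ℕ) / tval P (i : H b).1) ?_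
    intro i j hij
    have hLAS : (L * A * S) i j = (((i : H b).2 : ℕ) : TruncRing b.support M) *
        (P.pairingIn ℤ (i : H b).1 (j : H b).1 : TruncRing b.support M) := by
      have h1 : ∀ a, (L * A) i a = (((i : H b).2 : ℕ) : TruncRing b.support M) *
          (P.pairingIn ℤ (i : H b).1 a : TruncRing b.support M) := by
        intro a
        rw [Matrix.mul_apply, Finset.sum_eq_single (i : H b).1]
        · simp [L, A]
        · intro c _ hc
          simp [L, Finsupp.single_eq_of_ne hc]
        · simp
      rw [Matrix.mul_apply, Finset.sum_eq_single (j : H b).1]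
      · have h2 : colourMin ((j : H b).1, 1) (j : H b) = 1 := by
          have := (j : H b).2.pos
          simp only [colourMin, if_true, PNat.one_coe]
          norm_cast
          omega
        rw [h1]
        simp [S, h2]
      · intro c _ hc
        simp [S, colourMin, hc]
      · simp
    have hG : gramMin b (i : H b) j = ((i : H b).2 : ℕ) *
        P.pairingIn ℤ (i : H b).1 (j : H b).1 := by
      rw [← Int.cast_inj (α := ℚ), cast_gramMin, minT, min_eq_left, Int.cast_mul,
        ← rootInner_mul_tval]
      · push_cast
        ring
      · have hi := tval_pos P (i : H b).1
        have hj := tval_pos P (j : H b).1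
        rw [div_le_div_iff₀ hi hj] at hij
        linarith
    rw [Matrix.diagonal_mul, Matrix.sub_apply, hLAS]
    simp [G, hG]
  -- Row `a` of the Jacobian matrix is `Q̃_1^{(a)}` times a row of `1 - S x A`, because `S x`
  -- collects the logarithmic derivatives of the `Q̃_1^{(a)}`.
  have hJ : truncHom b.support M (jacobianMatrix Q).det =
      ((∏ a : b.support, qTrunc Q M a 1 : (TruncRing b.support M)ˣ) : TruncRing b.support M) *
        (1 - S * x * A).det := by
    rw [RingHom.map_det, Units.coe_prod, ← Matrix.det_diagonal, ← Matrix.det_mul]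
    congr 1
    ext a a'
    have hl : ∀ c, truncHom b.support M (eulerDer c (Q a 1 : MvPowerSeries b.support ℂ)) =
        (qTrunc Q M a 1 : TruncRing b.support M) * (S * x) a c := by
      intro c
      rw [← truncDer_truncHom, ← coe_qTrunc, ← mul_logDer, logDer_qTrunc M hQ, Matrix.mul_apply,
        ← Finset.sum_coe_sort (truncIndex b M), ← Finset.sum_neg_distrib]
      congr 1
      exact Finset.sum_congr rfl fun j _ => (mul_neg _ _).symm
    rw [Matrix.diagonal_mul, Matrix.sub_apply, Matrix.mul_apply, mul_sub, Finset.mul_sum,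
      RingHom.mapMatrix_apply, Matrix.map_apply, jacobianMatrix, Matrix.of_apply, map_sub, map_sum]
    congr 1
    · rw [Matrix.one_apply]
      split_ifs
      · rw [mul_one, coe_qTrunc]
      · rw [mul_zero, map_zero]
    · refine Finset.sum_congr rfl fun c _ => ?_
      rw [map_mul, hl, map_intCast]
      change (P.pairingIn ℤ c a' : TruncRing b.support M) * _ =
        _ * (_ * (P.pairingIn ℤ c a' : TruncRing b.support M))
      ring
  have hK := truncHom_Ktilde_zero_mul_det M hQ
  have hGu : (1 + Matrix.of fun i j : truncIndex b M => (gramMin b (i : H b) j :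
      TruncRing b.support M) * ((((zTrunc Q M j)⁻¹ : (TruncRing b.support M)ˣ) :
        TruncRing b.support M) - 1)) = 1 + G * Matrix.diagonal u := by
    congr 1
    ext i j
    rw [Matrix.mul_diagonal]
    rfl
  rw [hGu] at hK
  rw [hone] at hdet
  have hq := congrArg Units.val (prod_qTrunc_mul_prod_zTrunc M hQ)
  rw [Units.val_mul, Units.val_one] at hq
  rw [hJ]
  generalize (1 - S * x * A).det = d at *
  generalize (1 + G * Matrix.diagonal u).det = e at *
  generalize truncHom b.support M (Ktilde (0 : H b →₀ ℕ)) = k at *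
  generalize ((∏ a : b.support, qTrunc Q M a 1 : (TruncRing b.support M)ˣ) :
    TruncRing b.support M) = q at *
  generalize ((∏ j ∈ truncIndex b M, zTrunc Q M j : (TruncRing b.support M)ˣ) :
    TruncRing b.support M) = p at *
  -- From `k p e = 1`, `d e = 1` and `q p = 1` follows `q d = k`.
  linear_combination (-q * d) * hK + k * q * p * hdet + k * hq

end Jacobian

/-! ### From power series in `y` to formal sums of exponentials. -/

section Expansion

variable {ι K V W : Type*} [Fintype ι] [Field K] [CharZero K] [AddCommGroup V] [Module K V]
  [AddCommGroup W] [Module K W] {P : RootPairing ι K V W} [P.IsCrystallographic] {b : P.Base}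
  [P.IsRootSystem]

variable (b) in
/-- The map `rootSum` as a homomorphism. -/
def rootSumHom : (b.support →₀ ℕ) →+ V where
  toFun := rootSum
  map_zero' := by simp [rootSum]
  map_add' d e := by
    classical
    rw [rootSum, Finsupp.sum_add_index' (by simp) (by intros; rw [add_smul])]
    rfl

lemma rootSum_add (d e : b.support →₀ ℕ) :
    rootSum (b := b) (d + e) = rootSum d + rootSum e :=
  map_add (rootSumHom b) d e

lemma rootSum_zero : rootSum (b := b) 0 = 0 :=
  map_zero (rootSumHom b)

lemma rootSum_single (a : b.support) (n : ℕ) :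
    rootSum (b := b) (Finsupp.single a n) = n • P.root a := by
  exact Finsupp.sum_single_index (zero_smul ℕ (P.root a))

lemma repr_rootSum (d : b.support →₀ ℕ) (a : b.support) :
    b.toWeightBasis.repr (rootSum d) a = d a := by
  classical
  have h : ∀ (c : b.support) (n : ℕ), b.toWeightBasis.repr (n • P.root c) a =
      if c = a then (n : K) else 0 := by
    intro c n
    rw [map_nsmul, b.toWeightBasis_repr_root, Finsupp.smul_apply, Finsupp.single_apply]
    split_ifs <;> simp
  rw [rootSum, Finsupp.sum, map_sum, Finsupp.finsetSum_apply,
    Finset.sum_congr rfl fun c _ => h c (d c), Finset.sum_ite_eq']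
  split_ifs with ha
  · rfl
  · rw [Finsupp.notMem_support_iff.1 ha, Nat.cast_zero]

lemma rootSum_injective : Function.Injective (rootSum (b := b)) := by
  intro d e h
  ext a
  have h1 := repr_rootSum (b := b) d a
  rw [h, repr_rootSum] at h1
  exact_mod_cast h1.symm

lemma expand_sub_rootSum (μ : V) (f : MvPowerSeries b.support ℂ) (d : b.support →₀ ℕ) :
    expand b μ f (μ - rootSum d) = MvPowerSeries.coeff d f := by
  rw [expand]
  have h : ∀ e : b.support →₀ ℕ, μ - rootSum e = μ - rootSum d ↔ e = d := by
    intro e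
    rw [sub_right_inj]
    exact rootSum_injective.eq_iff
  simp only [h, finsum_eq_if]
  rw [finsum_eq_single _ d]
  · simp
  · intro e he
    simp [he]

lemma expand_eq_zero (μ : V) (f : MvPowerSeries b.support ℂ) {lam : V}
    (h : ∀ d : b.support →₀ ℕ, μ - rootSum d ≠ lam) : expand b μ f lam = 0 := by
  rw [expand]
  simp [h]

lemma exists_of_expand_ne_zero {μ : V} {f : MvPowerSeries b.support ℂ} {lam : V}
    (h : expand b μ f lam ≠ 0) : ∃ d : b.support →₀ ℕ, μ - rootSum d = lam := by
  by_contra hd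
  push Not at hd
  exact h (expand_eq_zero μ f hd)

variable (b) in
/-- The evaluation of polynomials at `y_a = e^{-α_a}`. -/
def evalExp : MvPolynomial b.support ℂ →+* AddMonoidAlgebra ℂ V :=
  AddMonoidAlgebra.mapDomainRingHom ℂ (-rootSumHom b)

lemma evalExp_monomial (d : b.support →₀ ℕ) (r : ℂ) :
    evalExp b (MvPolynomial.monomial d r) = AddMonoidAlgebra.single (-rootSum d) r := by
  change AddMonoidAlgebra.mapDomain (-rootSumHom b) (AddMonoidAlgebra.single d r) = _
  rw [AddMonoidAlgebra.mapDomain_single]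
  rfl

lemma coeff_single_one_mul (μ lam : V) (f : AddMonoidAlgebra ℂ V) :
    (AddMonoidAlgebra.single μ 1 * f).coeff lam = f.coeff (lam - μ) := by
  rw [AddMonoidAlgebra.coeff_single_mul_eq_mul_coeff (lam - μ), one_mul]
  intro m _
  rw [eq_sub_iff_add_eq, add_comm]

lemma coeff_single_mul_evalExp (μ lam : V) (g : MvPolynomial b.support ℂ) :
    (AddMonoidAlgebra.single μ 1 * evalExp b g).coeff lam =
      expand b μ (g : MvPowerSeries b.support ℂ) lam := by
  rw [coeff_single_one_mul]
  change (Finsupp.mapDomain (-rootSumHom b) (AddMonoidAlgebra.coeff g)) _ = _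
  have hinj : Function.Injective (-rootSumHom b : (b.support →₀ ℕ) →+ V) := by
    intro d e h
    exact rootSum_injective (neg_injective h)
  by_cases h : ∃ d : b.support →₀ ℕ, μ - rootSum d = lam
  · obtain ⟨d, rfl⟩ := h
    rw [expand_sub_rootSum, MvPolynomial.coeff_coe]
    have : μ - rootSum d - μ = (-rootSumHom b : (b.support →₀ ℕ) →+ V) d := by
      change _ = -rootSum d
      abel
    rw [this, Finsupp.mapDomain_apply hinj]
    rfl
  · push Not at h
    rw [expand_eq_zero μ _ h, Finsupp.mapDomain_of_notMem_range]
    rintro ⟨d, hd⟩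
    apply h d
    change -rootSum d = lam - μ at hd
    rw [sub_eq_add_neg, hd]
    abel

lemma mulFinite_add (c : V → ℂ) (g g' : AddMonoidAlgebra ℂ V) :
    mulFinite c (g + g') = mulFinite c g + mulFinite c g' := by
  classical
  funext lam
  simp only [mulFinite, Pi.add_apply, AddMonoidAlgebra.coeff_add]
  rw [Finsupp.sum_add_index' (by simp) (by intros; ring)]

lemma expand_add (μ : V) (f g : MvPowerSeries b.support ℂ) :
    expand b μ (f + g) = expand b μ f + expand b μ g := by
  funext lam
  by_cases h : ∃ d : b.support →₀ ℕ, μ - rootSum d = lam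
  · obtain ⟨d, rfl⟩ := h
    simp [expand_sub_rootSum]
  · push Not at h
    simp [expand_eq_zero μ _ h]

lemma mulFinite_expand_evalExp (μ : V) (f : MvPowerSeries b.support ℂ)
    (g : MvPolynomial b.support ℂ) :
    mulFinite (expand b μ f) (evalExp b g) =
      expand b μ (f * (g : MvPowerSeries b.support ℂ)) := by
  induction g using MvPolynomial.induction_on' with
  | add p q hp hq =>
    rw [map_add, mulFinite_add, hp, hq, MvPolynomial.coe_add, mul_add, expand_add]
  | monomial d r =>
    funext lam
    rw [evalExp_monomial, mulFinite, AddMonoidAlgebra.coeff_single,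
      Finsupp.sum_single_index (by simp), MvPolynomial.coe_monomial, sub_neg_eq_add]
    by_cases h : ∃ e : b.support →₀ ℕ, μ - rootSum e = lam
    · obtain ⟨e, rfl⟩ := h
      rw [expand_sub_rootSum, MvPowerSeries.coeff_mul_monomial]
      split_ifs with hde
      · have h1 : μ - rootSum e + rootSum d = μ - rootSum (e - d) := by
          nth_rw 1 [← tsub_add_cancel_of_le hde]
          rw [rootSum_add]
          abel
        rw [h1, expand_sub_rootSum, mul_comm]
      · rw [expand_eq_zero, mul_zero]
        intro e' he'
        apply hde
        have h1 : rootSum e = rootSum (e' + d) := by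
          rw [rootSum_add]
          have h2 : rootSum e = μ - (μ - rootSum e + rootSum d) + rootSum d := by abel
          rw [h2, ← he']
          abel
        rw [rootSum_injective h1]
        exact le_add_self
    · push Not at h
      rw [expand_eq_zero μ _ h, expand_eq_zero, mul_zero]
      intro e he
      apply h (e + d)
      rw [rootSum_add, ← sub_sub, he]
      abel

lemma exists_coe_eq {f : MvPowerSeries b.support ℂ}
    (hf : {d : b.support →₀ ℕ | MvPowerSeries.coeff d f ≠ 0}.Finite) :
    ∃ g : MvPolynomial b.support ℂ, (g : MvPowerSeries b.support ℂ) = f := by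
  classical
  refine ⟨∑ d ∈ hf.toFinset, MvPolynomial.monomial d (MvPowerSeries.coeff d f), ?_⟩
  ext e
  rw [MvPolynomial.coeff_coe, MvPolynomial.coeff_sum]
  simp only [MvPolynomial.coeff_monomial, Finset.sum_ite_eq', Set.Finite.mem_toFinset,
    Set.mem_ofPred_eq]
  split_ifs with h
  · rfl
  · exact (not_not.1 h).symm

end Expansion

/-! ### Finiteness of the Weyl group and vanishing of orbit sums. -/

section Weyl

variable {ι K V W : Type*} [Fintype ι] [Field K] [CharZero K] [AddCommGroup V] [Module K V]
  [AddCommGroup W] [Module K W] {P : RootPairing ι K V W} [P.IsCrystallographic] {b : P.Base}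
  [P.IsRootSystem]

variable (P) in
-- The roots span, so an element is determined by its permutation of the finitely many roots.
lemma finite_weylGroup : Finite P.weylGroup := by
  have h : Function.Injective fun w : P.weylGroup => P.weylGroupToPerm w := by
    intro w w' hw
    apply Subtype.ext
    apply RootPairing.Equiv.weightHom_injective P
    apply LinearEquiv.toLinearMap_injective
    have hspan : Submodule.span K (Set.range P.root) = ⊤ :=
      RootPairing.IsRootSystem.span_root_eq_top
    refine LinearMap.ext_on hspan ?_
    rintro _ ⟨i, rfl⟩
    have h1 := P.weylGroup_apply_root w i
    have h2 := P.weylGroup_apply_root w' i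
    have hw' : P.weylGroupToPerm w = P.weylGroupToPerm w' := hw
    rw [hw'] at h1
    exact h1.trans h2.symm
  exact Finite.of_injective _ h

lemma eq_zero_of_forall_coroot {x : V}
    (h : ∀ a : b.support, P.toLinearMap x (P.coroot a) = 0) : x = 0 := by
  apply P.toPerfPair.injective
  rw [map_zero]
  refine b.toCoweightBasis.ext fun a => ?_
  rw [b.toCoweightBasis_apply]
  exact h a

variable (b) in
include b in
-- The sum is fixed by every simple reflection, hence pairs to zero with every simple coroot.
lemma sum_weylGroup_smul [Fintype P.weylGroup] (x : V) : ∑ w : P.weylGroup, w • x = 0 := by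
  refine eq_zero_of_forall_coroot (b := b) fun a => ?_
  set s := ∑ w : P.weylGroup, w • x with hs
  have h1 : P.reflection a s = s := by
    rw [hs, map_sum]
    refine Fintype.sum_equiv (Equiv.mulLeft (RootPairing.weylGroup.ofIdx P a)) _ _ fun w => ?_
    rw [Equiv.coe_mulLeft, mul_smul]
    rfl
  rw [RootPairing.reflection_apply, sub_eq_self, smul_eq_zero] at h1
  exact h1.resolve_right (P.ne_zero a)

end Weyl

/-! ### Finiteness of invariants and uniqueness of antiinvariants. -/

section Antiinvariants

variable {ι K V W : Type*} [Fintype ι] [Field K] [CharZero K] [AddCommGroup V] [Module K V]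
  [AddCommGroup W] [Module K W] {P : RootPairing ι K V W} [P.IsCrystallographic] {b : P.Base}
  [P.IsRootSystem]

lemma IsWeylInvariant.apply_reflection {f : V → ℂ} (hf : IsWeylInvariant P f) (i : ι) (lam : V) :
    f (P.reflection i lam) = f lam :=
  hf (RootPairing.weylGroup.ofIdx P i) lam

variable (b) in
include b in
/-- A Weyl invariant sum with support in a cone `μ - ∑ ℕ α_a` is finite. -/
lemma finite_of_isWeylInvariant_expand {μ : V} {f : MvPowerSeries b.support ℂ}
    (hf : IsWeylInvariant P (expand b μ f)) :
    {d : b.support →₀ ℕ | MvPowerSeries.coeff d f ≠ 0}.Finite := by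
  classical
  have := finite_weylGroup P
  have := Fintype.ofFinite P.weylGroup
  -- The whole orbit of `μ - ∑ d_a α_a` lies in the cone, say at `μ - ∑ (e_w)_a α_a`. Since the
  -- orbit sum is zero, `∑_w e_w` is the expansion of `|W| μ` in simple roots; it does not depend on
  -- `d`, and it dominates `e_1 = d`.
  have key : ∀ d : b.support →₀ ℕ, MvPowerSeries.coeff d f ≠ 0 →
      ∃ e : b.support →₀ ℕ, d ≤ e ∧ rootSum e = Fintype.card P.weylGroup • μ := by
    intro d hd
    have h1 : ∀ w : P.weylGroup, ∃ e : b.support →₀ ℕ,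
        μ - rootSum e = w • (μ - rootSum d) := by
      intro w
      apply exists_of_expand_ne_zero (f := f)
      rw [hf w, expand_sub_rootSum]
      exact hd
    choose e he using h1
    refine ⟨∑ w, e w, ?_, ?_⟩
    · have h2 : e 1 = d := by
        apply rootSum_injective (b := b)
        have := he 1
        rwa [one_smul, sub_right_inj] at this
      rw [← h2]
      exact Finset.single_le_sum (f := e) (fun _ _ => zero_le) (Finset.mem_univ 1)
    · have h3 := sum_weylGroup_smul b (μ - rootSum d)
      rw [← Finset.sum_congr rfl fun w _ => he w, Finset.sum_sub_distrib, Finset.sum_const,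
        sub_eq_zero, Finset.card_univ] at h3
      rw [h3]
      exact map_sum (rootSumHom b) e Finset.univ
  by_cases hne : ∃ d, MvPowerSeries.coeff d f ≠ 0
  · obtain ⟨d₀, hd₀⟩ := hne
    obtain ⟨e₀, -, he₀⟩ := key d₀ hd₀
    refine (Set.finite_Iic e₀).subset fun d hd => ?_
    obtain ⟨e, hde, he⟩ := key d hd
    rw [← he₀] at he
    rw [← rootSum_injective he]
    exact hde
  · push Not at hne
    simp [hne]

variable (P) in
/-- The action of a reflection on the group algebra. -/
def reflHom (i : ι) : AddMonoidAlgebra ℂ V →+* AddMonoidAlgebra ℂ V :=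
  AddMonoidAlgebra.mapDomainRingHom ℂ (P.reflection i : V →ₗ[K] V).toAddMonoidHom

lemma reflHom_single (i : ι) (μ : V) (r : ℂ) :
    reflHom P i (AddMonoidAlgebra.single μ r) = AddMonoidAlgebra.single (P.reflection i μ) r :=
  AddMonoidAlgebra.mapDomain_single

lemma coeff_reflHom (i : ι) (f : AddMonoidAlgebra ℂ V) (lam : V) :
    (reflHom P i f).coeff lam = f.coeff (P.reflection i lam) := by
  change Finsupp.mapDomain (P.reflection i) f.coeff lam = _
  conv_lhs => rw [← P.reflection_same i lam]
  exact Finsupp.mapDomain_apply (P.reflection i).injective _ _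

/-- A combination `d` of simple roots with `⟨d, α_c⟩ ≤ 0` for all `c` vanishes. -/
lemma eq_zero_of_sum_mul_pairing_nonpos (d : b.support →₀ ℕ)
    (h : ∀ c : b.support, ∑ a : b.support, (d a : ℤ) * P.pairingIn ℤ a c ≤ 0) : d = 0 := by
  classical
  -- The symmetrized Cartan form is positive definite, but its value at `d` is a sum of nonpositive
  -- terms.
  obtain ⟨δ, hδ, hpos⟩ := b.exists_cartanMatrix_mul_diagaonal_posDef
  by_contra hd
  have hx : (fun a => (d a : ℤ)) ≠ 0 := by
    intro h0
    apply hd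
    ext a
    have := congrFun h0 a
    simpa using this
  have h1 := hpos.dotProduct_mulVec_pos hx
  have h2 : star (fun a => (d a : ℤ)) ⬝ᵥ (b.cartanMatrix * Matrix.diagonal δ).mulVec
      (fun a => (d a : ℤ)) =
      ∑ c, δ c * d c * ∑ a : b.support, (d a : ℤ) * P.pairingIn ℤ a c := by
    simp only [dotProduct, Matrix.mulVec, Matrix.mul_diagonal, Pi.star_apply, star_trivial,
      Finset.mul_sum]
    rw [Finset.sum_comm]
    refine Finset.sum_congr rfl fun c _ => Finset.sum_congr rfl fun a _ => ?_
    change (d a : ℤ) * (P.pairingIn ℤ a c * δ c * d c) = _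
    ring
  rw [h2] at h1
  refine absurd h1 (not_lt.2 (Finset.sum_nonpos fun c _ => ?_))
  have := (hδ c).le
  exact mul_nonpos_of_nonneg_of_nonpos (by positivity) (h c)

variable (b) in
/-- The sum of the fundamental weights. -/
def weylVector : V := ∑ a : b.support, fundWeight a

lemma toLinearMap_weylVector (c : b.support) :
    P.toLinearMap (weylVector b) (P.coroot c) = 1 := by
  classical
  rw [weylVector, map_sum, LinearMap.sum_apply]
  simp [toLinearMap_fundWeight]

lemma toLinearMap_rootSum (d : b.support →₀ ℕ) (c : b.support) :
    P.toLinearMap (rootSum d) (P.coroot c) =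
      ((∑ a : b.support, (d a : ℤ) * P.pairingIn ℤ a c : ℤ) : K) := by
  rw [rootSum, Finsupp.sum_fintype _ _ (by simp), map_sum, LinearMap.sum_apply]
  push_cast
  refine Finset.sum_congr rfl fun a _ => ?_
  rw [map_nsmul, LinearMap.smul_apply, P.root_coroot_eq_pairing, ← P.algebraMap_pairingIn ℤ,
    nsmul_eq_mul]
  rfl

lemma reflection_weylVector_sub_rootSum (d : b.support →₀ ℕ) (c : b.support) :
    P.reflection c (weylVector b - rootSum d) = weylVector b - rootSum d -
      (1 - ∑ a : b.support, (d a : ℤ) * P.pairingIn ℤ a c : ℤ) • P.root c := by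
  rw [RootPairing.reflection_apply]
  congr 1
  change P.toLinearMap (weylVector b - rootSum d) (P.coroot c) • P.root c = _
  rw [map_sub, LinearMap.sub_apply, toLinearMap_weylVector, toLinearMap_rootSum,
    ← Int.cast_smul_eq_zsmul K]
  push_cast
  rfl

/-- An antiinvariant with leading exponent less than the Weyl vector vanishes. -/
lemma eq_zero_of_antiinvariant {g : MvPolynomial b.support ℂ}
    (hanti : ∀ c : b.support, reflHom P c (AddMonoidAlgebra.single (weylVector b) 1 * evalExp b g) =
      -(AddMonoidAlgebra.single (weylVector b) 1 * evalExp b g))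
    (h0 : MvPolynomial.coeff 0 g = 0) : g = 0 := by
  classical
  have hco : ∀ (c : b.support) (lam : V),
      expand b (weylVector b) (g : MvPowerSeries b.support ℂ) (P.reflection c lam) =
        -expand b (weylVector b) (g : MvPowerSeries b.support ℂ) lam := by
    intro c lam
    have h := congrArg (fun f => AddMonoidAlgebra.coeff f lam) (hanti c)
    simp only [coeff_reflHom, AddMonoidAlgebra.coeff_neg, Finsupp.neg_apply,
      coeff_single_mul_evalExp] at h
    exact h
  by_contra hg
  have hne : g.support.Nonempty := by
    rwa [Finset.nonempty_iff_ne_empty, Ne, MvPolynomial.support_eq_empty]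
  obtain ⟨d, hd, hmin⟩ := g.support.exists_min_image (fun d => d.degree) hne
  rw [MvPolynomial.mem_support_iff] at hd
  suffices hd0 : d = 0 by
    rw [hd0] at hd
    exact hd h0
  -- Suppose the pairing `s` with `α_c` is positive. Reflecting `ρ - d` gives the exponent `ρ - (d -
  -- (s - 1) α_c)`, also in the support. Minimality of the degree of `d` forces `s = 1`; then the
  -- exponent is fixed by the reflection, and its coefficient equals its own negative.
  refine eq_zero_of_sum_mul_pairing_nonpos d fun c => ?_
  by_contra hs
  push Not at hs
  have h1 := hco c (weylVector b - rootSum d)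
  rw [expand_sub_rootSum, MvPolynomial.coeff_coe, reflection_weylVector_sub_rootSum] at h1
  set s := ∑ a : b.support, (d a : ℤ) * P.pairingIn ℤ a c with hsdef
  obtain ⟨e, he⟩ := exists_of_expand_ne_zero (b := b)
    (f := (g : MvPowerSeries b.support ℂ)) (μ := weylVector b)
    (lam := weylVector b - rootSum d - (1 - s) • P.root c) (by rw [h1]; exact neg_ne_zero.2 hd)
  rw [← he, expand_sub_rootSum, MvPolynomial.coeff_coe] at h1
  have hes : e + Finsupp.single c (s - 1).toNat = d := by
    apply rootSum_injective (b := b)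
    rw [rootSum_add, rootSum_single, ← natCast_zsmul, Int.toNat_of_nonneg (by omega)]
    have h2 : rootSum e = weylVector b - (weylVector b - rootSum e) := by abel
    rw [h2, he, sub_smul, sub_smul]
    abel
  have hle := hmin e (MvPolynomial.mem_support_iff.2 (by rw [h1]; exact neg_ne_zero.2 hd))
  have hdeg := congrArg Finsupp.degree hes
  rw [map_add, Finsupp.degree_single] at hdeg
  have hz : (s - 1).toNat = 0 := by omega
  rw [hz, Finsupp.single_zero, add_zero] at hes
  rw [hes] at h1
  exact hd (by linear_combination h1 / 2)

end Antiinvariants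

/-! ### The Weyl denominator: polynomial form and antiinvariance. -/

section Denominator

variable {ι K V W : Type*} [Fintype ι] [Field K] [CharZero K] [AddCommGroup V] [Module K V]
  [AddCommGroup W] [Module K W] {P : RootPairing ι K V W} [P.IsCrystallographic] {b : P.Base}
  [P.IsRootSystem]

lemma exists_rootSum_eq_root {i : ι} (hi : b.IsPos i) :
    ∃ d : b.support →₀ ℕ, d ≠ 0 ∧ rootSum d = P.root i := by
  classical
  obtain ⟨f, hf, hroot⟩ := b.exists_root_eq_sum_nat_or_neg i
  have hsum : ∑ j ∈ b.support, f j • P.root j =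
      rootSum (b := b) (Finsupp.equivFunOnFinite.symm fun a => f a) := by
    rw [rootSum, Finsupp.sum_fintype _ _ (by simp), ← Finset.sum_coe_sort]
    rfl
  have hr : P.root i = ∑ j ∈ b.support, f j • P.root j := by
    refine hroot.resolve_right fun hneg => ?_
    have hneg' : P.root i = ∑ j ∈ b.support, (-(f j : ℤ)) • P.root j := by
      rw [hneg, ← Finset.sum_neg_distrib]
      exact Finset.sum_congr rfl fun j _ => by rw [neg_smul, natCast_zsmul]
    have hh := RootPairing.Base.height_eq_sum (b := b) (f := fun j => -(f j : ℤ)) hneg'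
    rw [RootPairing.Base.isPos_iff, hh] at hi
    exact absurd hi (not_lt.2 (Finset.sum_nonpos fun j _ => by simp))
  refine ⟨_, ?_, hsum.symm.trans hr.symm⟩
  intro h0
  rw [h0, rootSum_zero] at hsum
  exact P.ne_zero i (hr.trans hsum)

variable (b) in
lemma exists_evalExp_eq_weylDenominator :
    ∃ g : MvPolynomial b.support ℂ, MvPolynomial.coeff 0 g = 1 ∧
      evalExp b g = weylDenominator b := by
  classical
  have h : ∀ i : ι, ∃ d : b.support →₀ ℕ, b.IsPos i → d ≠ 0 ∧ rootSum d = P.root i := by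
    intro i
    by_cases hi : b.IsPos i
    · obtain ⟨d, hd⟩ := exists_rootSum_eq_root hi
      exact ⟨d, fun _ => hd⟩
    · exact ⟨0, fun h => absurd h hi⟩
  choose d hd using h
  refine ⟨∏ i : ι with b.IsPos i, (1 - MvPolynomial.monomial (d i) 1), ?_, ?_⟩
  · rw [← MvPolynomial.constantCoeff_eq, map_prod]
    refine Finset.prod_eq_one fun i hi => ?_
    rw [map_sub, map_one, MvPolynomial.constantCoeff_monomial,
      if_neg (hd i (Finset.mem_filter.1 hi).2).1, sub_zero]
  · rw [weylDenominator, map_prod]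
    have hfil : ∀ (I J : DecidablePred b.IsPos), @Finset.filter ι b.IsPos I Finset.univ =
        @Finset.filter ι b.IsPos J Finset.univ := by
      intro I J
      congr
    rw [hfil]
    refine Finset.prod_congr rfl fun i hi => ?_
    rw [map_sub, map_one, evalExp_monomial, (hd i (Finset.mem_filter.1 hi).2).2]

variable [P.IsReduced]

/-- The simple reflection permutes the positive roots other than `α_c`, and sends `ρ` to `ρ - α_c`;
the remaining factor `e^ρ (1 - e^{-α_c})` changes sign. -/
lemma reflHom_weylDenominator (c : b.support) :
    reflHom P c (AddMonoidAlgebra.single (weylVector b) 1 * weylDenominator b) =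
      -(AddMonoidAlgebra.single (weylVector b) 1 * weylDenominator b) := by
  classical
  have hneg : ¬ b.IsPos (P.reflectionPerm c c) := by
    intro h
    rw [RootPairing.Base.isPos_iff] at h
    have h1 := b.height_reflectionPerm_self c
    have h2 : b.height (P.reflectionPerm c c) = -b.height c := h1
    rw [h2, RootPairing.Base.height_one_of_mem_support c.2] at h
    omega
  have hmaps : ∀ i ∈ (Finset.univ.filter b.IsPos).erase (c : ι),
      P.reflectionPerm c i ∈ (Finset.univ.filter b.IsPos).erase (c : ι) := by
    intro i hi
    rw [Finset.mem_erase, Finset.mem_filter] at hi ⊢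
    refine ⟨?_, Finset.mem_univ _, hi.2.2.reflectionPerm c.2 hi.1⟩
    intro h
    apply hneg
    have h' := congrArg (P.reflectionPerm c) h
    rw [P.reflectionPerm_self] at h'
    rw [← h']
    exact hi.2.2
  have hperm : reflHom P c (∏ i ∈ (Finset.univ.filter b.IsPos).erase (c : ι),
      (1 - AddMonoidAlgebra.single (-P.root i) (1 : ℂ))) =
      ∏ i ∈ (Finset.univ.filter b.IsPos).erase (c : ι),
        (1 - AddMonoidAlgebra.single (-P.root i) (1 : ℂ)) := by
    rw [map_prod]
    refine Finset.prod_nbij' (P.reflectionPerm c) (P.reflectionPerm c) hmaps hmaps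
      (fun i _ => P.reflectionPerm_self c i) (fun i _ => P.reflectionPerm_self c i) fun i _ => ?_
    rw [map_sub, map_one, reflHom_single, map_neg, P.root_reflectionPerm]
  have hmem : (c : ι) ∈ Finset.univ.filter b.IsPos :=
    Finset.mem_filter.2 ⟨Finset.mem_univ _, RootPairing.Base.isPos_of_mem_support c.2⟩
  have hden : weylDenominator b = (1 - AddMonoidAlgebra.single (-P.root c) (1 : ℂ)) *
      ∏ i ∈ (Finset.univ.filter b.IsPos).erase (c : ι),
        (1 - AddMonoidAlgebra.single (-P.root i) (1 : ℂ)) := by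
    rw [Finset.mul_prod_erase _ (fun i => (1 - AddMonoidAlgebra.single (-P.root i) (1 : ℂ))) hmem,
      weylDenominator]
  have hρ : P.reflection c (weylVector b) = weylVector b - P.root c := by
    have h := reflection_weylVector_sub_rootSum (b := b) 0 c
    simpa [rootSum_zero] using h
  rw [hden, map_mul, map_mul, hperm, ← mul_assoc, ← mul_assoc, ← neg_mul]
  congr 1
  rw [map_sub, map_one, reflHom_single, reflHom_single, hρ, map_neg, P.reflection_apply_self,
    neg_neg, mul_sub, mul_sub, mul_one, mul_one, AddMonoidAlgebra.single_mul_single,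
    AddMonoidAlgebra.single_mul_single, sub_add_cancel, mul_one, neg_sub,
    ← sub_eq_add_neg (weylVector b)]

end Denominator

/-! ### Antiinvariance of the Jacobian determinant. -/

section Numerator

/-- Pairings of vectors with coroots lie in `K`, coefficients of formal sums in `ℂ`. A `ℚ`-linear
retraction of `K` onto `ℚ` transports the former; additivity suffices, because reflections involve
only integer multiples. -/
lemma exists_addMonoidHom_complex (K : Type*) [Field K] [CharZero K] :
    ∃ π : K →+ ℂ, π 1 = 1 := by
  have hinj : LinearMap.ker (Algebra.linearMap ℚ K) = ⊥ :=
    LinearMap.ker_eq_bot.2 (algebraMap ℚ K).injective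
  obtain ⟨g, hg⟩ := (Algebra.linearMap ℚ K).exists_leftInverse_of_injective hinj
  refine ⟨(algebraMap ℚ ℂ : ℚ →+* ℂ).toAddMonoidHom.comp g.toAddMonoidHom, ?_⟩
  have h1 : g 1 = 1 := by
    have := LinearMap.congr_fun hg 1
    simpa using this
  change algebraMap ℚ ℂ (g 1) = 1
  rw [h1, map_one]

lemma addMonoidHom_intCast_mul {K : Type*} [Field K] (π : K →+ ℂ) (n : ℤ) (x : K) :
    π (n * x) = n * π x := by
  rw [← zsmul_eq_mul, map_zsmul, zsmul_eq_mul]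

variable {ι K V W : Type*} [Fintype ι] [Field K] [CharZero K] [AddCommGroup V] [Module K V]
  [AddCommGroup W] [Module K W] {P : RootPairing ι K V W} [P.IsCrystallographic] {b : P.Base}
  [P.IsRootSystem]

/-- `x_{a'} ∂/∂x_{a'}` multiplies `e^λ` by the pairing of `λ` with the coroot of `a'`. -/
lemma coeff_jacobianMatrix (Q : b.support → ℕ → (MvPowerSeries b.support ℂ)ˣ) {π : K →+ ℂ}
    (hπ : π 1 = 1) (a a' : b.support) (d : b.support →₀ ℕ) :
    MvPowerSeries.coeff d (jacobianMatrix Q a a') =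
      π (P.toLinearMap (fundWeight a - rootSum d) (P.coroot a')) *
        MvPowerSeries.coeff d (Q a 1 : MvPowerSeries b.support ℂ) := by
  classical
  have hint : ∀ n : ℤ, π n = n := fun n => by
    have := addMonoidHom_intCast_mul π n 1
    rwa [mul_one, hπ, mul_one] at this
  have h1 : π (P.toLinearMap (fundWeight a - rootSum d) (P.coroot a')) =
      (if a = a' then 1 else 0) - ∑ c : b.support, (P.pairingIn ℤ c a' : ℂ) * d c := by
    rw [map_sub, LinearMap.sub_apply, toLinearMap_fundWeight, toLinearMap_rootSum, map_sub, hint]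
    push_cast
    congr 1
    · split_ifs <;> simp [hπ]
    · exact Finset.sum_congr rfl fun c _ => mul_comm _ _
  rw [h1, sub_mul, Finset.sum_mul, jacobianMatrix, Matrix.of_apply, map_sub, map_sum]
  congr 1
  · split_ifs <;> simp_all
  · refine Finset.sum_congr rfl fun c _ => ?_
    rw [← zsmul_eq_mul, map_zsmul, coeff_eulerDer, zsmul_eq_mul, mul_assoc]

lemma expand_jacobianMatrix (Q : b.support → ℕ → (MvPowerSeries b.support ℂ)ˣ) {π : K →+ ℂ}
    (hπ : π 1 = 1) (a a' : b.support) (lam : V) :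
    expand b (fundWeight a) (jacobianMatrix Q a a') lam =
      π (P.toLinearMap lam (P.coroot a')) * Qx Q a 1 lam := by
  rw [Qx, one_smul]
  by_cases h : ∃ d : b.support →₀ ℕ, fundWeight a - rootSum d = lam
  · obtain ⟨d, rfl⟩ := h
    rw [expand_sub_rootSum, expand_sub_rootSum, coeff_jacobianMatrix Q hπ]
  · push Not at h
    rw [expand_eq_zero _ _ h, expand_eq_zero _ _ h, mul_zero]

lemma det_one_sub_single_mul {n R : Type*} [Fintype n] [DecidableEq n] [CommRing R] (c : n)
    (v : n → R) : (1 - Matrix.of fun k j => if k = c then v j else 0).det = 1 - v c := by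
  have h : (1 - Matrix.of fun k j => if k = c then v j else 0) =
      1 + Matrix.replicateCol Unit (Pi.single c (-1 : R)) * Matrix.replicateRow Unit v := by
    ext k j
    rw [Matrix.add_apply, Matrix.sub_apply, Matrix.mul_apply]
    by_cases hk : k = c
    · subst hk; simp [sub_eq_add_neg]
    · simp [hk]
  rw [h, Matrix.det_one_add_replicateCol_mul_replicateRow]
  simp [sub_eq_add_neg]

variable [P.IsReduced]

/-- The entries `N a a'` have coefficients `⟨λ, α_{a'}^∨⟩` times those of the invariant
`Q_1^{(a)}(x)`. A reflection therefore acts only on the pairings, that is, by right multiplication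
by a matrix differing from `1` in one row, of determinant `1 - 2 = -1`. The factors `e^{Λ_a}` of the
rows multiply to `e^ρ`. -/
lemma exists_coe_eq_det_jacobianMatrix [DecidableEq b.support]
    {Q : b.support → ℕ → (MvPowerSeries b.support ℂ)ˣ}
    (hW : ∀ a : b.support, IsWeylInvariant P (Qx Q a 1)) :
    ∃ g : MvPolynomial b.support ℂ,
      (g : MvPowerSeries b.support ℂ) = (jacobianMatrix Q).det ∧
      ∀ c : b.support, reflHom P c (AddMonoidAlgebra.single (weylVector b) 1 * evalExp b g) =
        -(AddMonoidAlgebra.single (weylVector b) 1 * evalExp b g) := by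
  obtain ⟨π, hπ⟩ := exists_addMonoidHom_complex K
  have hpoly : ∀ a a' : b.support, ∃ g : MvPolynomial b.support ℂ,
      (g : MvPowerSeries b.support ℂ) = jacobianMatrix Q a a' := by
    intro a a'
    refine exists_coe_eq ((finite_of_isWeylInvariant_expand b (hW a)).subset fun d hd h0 => hd ?_)
    rw [coeff_jacobianMatrix Q hπ, h0, mul_zero]
  choose J hJ using hpoly
  let N : Matrix b.support b.support (AddMonoidAlgebra ℂ V) := Matrix.of fun a a' =>
    AddMonoidAlgebra.single (fundWeight a) 1 * evalExp b (J a a')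
  have hN : ∀ a a' lam, (N a a').coeff lam =
      π (P.toLinearMap lam (P.coroot a')) * Qx Q a 1 lam := by
    intro a a' lam
    rw [← expand_jacobianMatrix Q hπ, ← hJ]
    exact coeff_single_mul_evalExp _ _ _
  have hdet : N.det =
      AddMonoidAlgebra.single (weylVector b) 1 * evalExp b (Matrix.of J).det := by
    have h1 : ∀ s : Finset b.support, ∏ a ∈ s, AddMonoidAlgebra.single (fundWeight a) (1 : ℂ) =
        AddMonoidAlgebra.single (∑ a ∈ s, fundWeight a) 1 := by
      intro s
      induction s using Finset.induction_on with
      | empty => rfl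
      | insert a s ha ih =>
        rw [Finset.prod_insert ha, Finset.sum_insert ha, ih, AddMonoidAlgebra.single_mul_single,
          one_mul]
    have h2 := Matrix.det_mul_column
      (fun a : b.support => AddMonoidAlgebra.single (fundWeight a) (1 : ℂ))
      ((evalExp b).mapMatrix (Matrix.of J))
    rw [h1, ← RingHom.map_det] at h2
    exact h2
  refine ⟨(Matrix.of J).det, ?_, fun c => ?_⟩
  · have h1 := RingHom.map_det (MvPolynomial.coeToMvPowerSeries.ringHom (R := ℂ)) (Matrix.of J)
    refine h1.trans (congrArg Matrix.det ?_)
    ext1 a a'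
    exact hJ a a'
  · have hrefl : (reflHom P c).mapMatrix N = N * (1 - Matrix.of fun k j : b.support =>
        if k = c then ((P.pairingIn ℤ c j : ℤ) : AddMonoidAlgebra ℂ V) else 0) := by
      ext1 a a'
      rw [RingHom.mapMatrix_apply, Matrix.map_apply, mul_sub, mul_one, Matrix.sub_apply, Matrix.mul_apply]
      simp only [Matrix.of_apply, mul_ite, mul_zero, Finset.sum_ite_eq', Finset.mem_univ, if_true]
      ext lam
      rw [mul_comm (N a c), ← zsmul_eq_mul, AddMonoidAlgebra.coeff_sub, Finsupp.sub_apply]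
      change (reflHom P c (N a a')).coeff lam = _ - P.pairingIn ℤ c a' • (N a c).coeff lam
      rw [coeff_reflHom, hN, hN, hN, (hW a).apply_reflection, RootPairing.reflection_apply,
        map_sub, LinearMap.sub_apply, map_smul, LinearMap.smul_apply,
        P.root_coroot_eq_pairing, ← P.algebraMap_pairingIn ℤ, smul_eq_mul, mul_comm (_ : K),
        zsmul_eq_mul, map_sub]
      change (_ - π ((P.pairingIn ℤ c a' : K) * P.toLinearMap lam (P.coroot c))) * _ = _
      rw [addMonoidHom_intCast_mul]
      ring
    rw [← hdet, RingHom.map_det, hrefl, Matrix.det_mul, det_one_sub_single_mul]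
    have hcc : P.pairingIn ℤ c c = 2 := by
      apply FaithfulSMul.algebraMap_injective ℤ K
      rw [P.algebraMap_pairingIn, P.pairing_same, map_ofNat]
    rw [hcc]
    push_cast
    ring

end Numerator

/-! ### Comparison with the Weyl denominator and extraction of coefficients. -/

section Main

variable {ι K V W : Type*} [Fintype ι] [Field K] [CharZero K] [AddCommGroup V] [Module K V]
  [AddCommGroup W] [Module K W] {P : RootPairing ι K V W} [P.IsCrystallographic] {b : P.Base}
  [P.IsRootSystem]

lemma coeff_Ktilde (ν : H b →₀ ℕ) (d : b.support →₀ ℕ) :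
    MvPowerSeries.coeff d (Ktilde ν) =
      ∑ᶠ (N : H b →₀ ℕ) (_ : content N = d), (Knum ν N : ℂ) := rfl

lemma coeff_zero_Ktilde_zero : MvPowerSeries.coeff 0 (Ktilde (0 : H b →₀ ℕ)) = 1 := by
  classical
  rw [coeff_Ktilde, finsum_eq_single _ 0]
  · have h : content (0 : H b →₀ ℕ) = 0 := Finsupp.sum_zero_index
    rw [finsum_eq_if, if_pos h, Knum]
    simp
  · intro N hN
    rw [finsum_eq_if, if_neg]
    intro h
    apply hN
    ext p
    by_contra hp
    have h1 : (content N) p.1 = 0 := by rw [h]; rfl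
    rw [content, Finsupp.sum, Finsupp.finsetSum_apply, Finset.sum_eq_zero_iff] at h1
    have h2 := h1 p (Finsupp.mem_support_iff.2 hp)
    rw [Finsupp.single_eq_same] at h2
    exact (mul_ne_zero p.2.ne_zero hp) h2

lemma sum_smul_root_eq_rootSum_content (N : H b →₀ ℕ) :
    (N.sum fun p n => ((p.2 : ℕ) * n) • P.root p.1) = rootSum (content N) := by
  change _ = rootSumHom b (content N)
  rw [content, Finsupp.sum, Finsupp.sum, map_sum]
  exact Finset.sum_congr rfl fun p _ => (rootSum_single _ _).symm

lemma finite_Nset_and_expand_Ktilde (ν μ : H b →₀ ℕ) (lam : V) :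
    (Nset ν lam).Finite ∧
      expand b (weight ν) (Ktilde μ) lam = ∑ᶠ N ∈ Nset ν lam, (Knum μ N : ℂ) := by
  have hmem : ∀ N, N ∈ Nset ν lam ↔ weight ν - rootSum (content N) = lam := by
    intro N
    rw [← sum_smul_root_eq_rootSum_content]
    rfl
  by_cases h : ∃ d : b.support →₀ ℕ, weight ν - rootSum d = lam
  · obtain ⟨d, rfl⟩ := h
    have hset : ∀ N : H b →₀ ℕ, N ∈ Nset ν (weight ν - rootSum d) ↔ content N = d := by
      intro N
      rw [hmem, sub_right_inj, rootSum_injective.eq_iff]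
    refine ⟨(finite_content d).subset fun N hN => (hset N).1 hN, ?_⟩
    rw [expand_sub_rootSum, coeff_Ktilde]
    simp only [hset]
  · push Not at h
    have hset : ∀ N : H b →₀ ℕ, ¬ N ∈ Nset ν lam := fun N hN => h _ ((hmem N).1 hN)
    have hempty : Nset ν lam = ∅ := Set.eq_empty_of_forall_notMem hset
    rw [expand_eq_zero _ _ h, hempty]
    simp

variable [P.IsReduced] [P.IsIrreducible]

/-- The fermionic series `K̃^0` is a polynomial, whose value is the Weyl denominator. -/
lemma exists_coe_eq_Ktilde_zero {Q : b.support → ℕ → (MvPowerSeries b.support ℂ)ˣ}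
    (hQ : IsQFamily b Q) (hW : ∀ a : b.support, IsWeylInvariant P (Qx Q a 1)) :
    ∃ g : MvPolynomial b.support ℂ, (g : MvPowerSeries b.support ℂ) = Ktilde (0 : H b →₀ ℕ) ∧
      evalExp b g = weylDenominator b := by
  classical
  obtain ⟨g, hg, hanti⟩ := exists_coe_eq_det_jacobianMatrix hW
  rw [det_jacobianMatrix hQ] at hg
  obtain ⟨w, hw0, hw⟩ := exists_evalExp_eq_weylDenominator b
  have h0 : MvPolynomial.coeff 0 g = 1 := by
    rw [← MvPolynomial.coeff_coe, hg, coeff_zero_Ktilde_zero]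
  -- Both constant terms are `1`, so the antiinvariant `e^ρ (g - w)` has no term at `e^ρ`.
  have hgw : g - w = 0 := by
    refine eq_zero_of_antiinvariant (b := b) (fun c => ?_) ?_
    · rw [map_sub, mul_sub, map_sub, hanti, hw, reflHom_weylDenominator]
      ring
    · rw [MvPolynomial.coeff_sub, h0, hw0, sub_self]
  exact ⟨g, hg, by rw [sub_eq_zero.1 hgw, hw]⟩

end Main

end QSystem

end

theorem proposition4p8 {ι K V W : Type*} [Fintype ι] [Field K] [CharZero K]
    [AddCommGroup V] [Module K V] [AddCommGroup W] [Module K W]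
    (P : RootPairing ι K V W) [P.IsRootSystem] [P.IsCrystallographic] [P.IsReduced]
    [P.IsIrreducible] (b : P.Base)
    (Q : b.support → ℕ → (MvPowerSeries b.support ℂ)ˣ) (hQ : QSystem.IsQFamily b Q)
    (hW : ∀ a : b.support, QSystem.IsWeylInvariant P (QSystem.Qx Q a 1)) :
    (∀ lam : V, QSystem.Kx (0 : QSystem.H b →₀ ℕ) lam =
      (QSystem.weylDenominator b).coeff lam) ∧
    ∀ (ν : QSystem.H b →₀ ℕ) (lam : V),
      (QSystem.Nset ν lam).Finite ∧
      QSystem.kcoeff Q ν lam = ∑ᶠ N ∈ QSystem.Nset ν lam, (QSystem.Knum ν N : ℂ) := by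
  obtain ⟨g, hg, hgw⟩ := QSystem.exists_coe_eq_Ktilde_zero hQ hW
  refine ⟨fun lam => ?_, fun ν lam => ?_⟩
  · rw [QSystem.Kx, ← hg, ← hgw, ← QSystem.coeff_single_mul_evalExp]
    have h0 : QSystem.weight (0 : QSystem.H b →₀ ℕ) = 0 := Finsupp.sum_zero_index
    rw [h0]
    change (1 * QSystem.evalExp b g).coeff lam = _
    rw [one_mul]
  · obtain ⟨h1, h2⟩ := QSystem.finite_Nset_and_expand_Ktilde ν ν lam
    refine ⟨h1, ?_⟩
    -- With the denominator replaced by `K̃^0`, the product becomes the expansion of `Q̃^ν K̃^0 =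
    -- K̃^ν`.
    rw [← h2, QSystem.kcoeff, QSystem.Qnu, ← hgw, QSystem.mulFinite_expand_evalExp, hg,
      ← QSystem.Ktilde_eq_Qtilde_mul hQ]
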